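/- **Definitions.** For a natural transformation $\theta$ and an endofunctor $M$, $\theta_M$ has components $\theta_{Ma}$ and $M\theta$ has components $M(\theta_a)$. A *commutative bialgebraic monad* is a category $\mathcal A$ with an endofunctor $M$ and natural transformations $\nabla: MM\to M$, $!: I\to M$, $\Delta: M\to MM$, $\bar{!}: M\to I$, $\tau: MM\to MM$ such that $(M,\nabla,!)$ is a monad, $(M,\Delta,\bar{!})$ is a comonad, $\tau\circ\tau=1$, $$M\tau\circ\tau_M\circ M\tau=\tau_M\circ M\tau\circ\tau_M,$$ $$\nabla\circ\tau=\nabla,\quad \tau\circ\Delta=\Delta,\quad \tau\circ\nabla_M=M\nabla\circ\tau_M\circ M\tau,\quad \Delta_M\circ\tau=M\tau\circ\tau_M\circ M\Delta,\quad \tau\circ{!_M}=M!,\quad \bar{!}_M\circ\tau=M\bar{!},$$ $$\bar{!}\circ{!}=1,\quad \bar{!}\circ\nabla=\bar{!}\circ M\bar{!},\quad \Delta\circ{!}=M!\circ{!},\quad \Delta\circ\nabla=M\nabla\circ\nabla_{MM}\circ M\tau_M\circ MM\Delta\circ\Delta_M .$$ It is a *relational bialgebraic monad* if moreover $\nabla\circ\Delta=1_M$.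 $\mathcal{RB}$ is the syntactic category whose objects are $M^n0$ ($n\ge 0$), identified with $n$, and whose arrows are the terms built from identities and the components of $\nabla,\Delta,!,\bar{!},\tau$ by composition and $M$, modulo the congruence generated by the equations of a category, of an endofunctor, of naturality and of a relational bialgebraic monad. $\mathcal{RB}_{\mathrm I}$ has the finite ordinals as objects; its arrow terms are built by composition from ${}_n1_m: n+m\to n+m$, ${}_n\nabla^k_m: n+2k+m\to n+k+m$, ${}_n\Delta^k_m: n+k+m\to n+2k+m$, ${}_n!^k_m: n+m\to n+k+m$ and ${}_n\bar{!}^k_m: n+k+m\to n+m$. A subscript $0$ is omitted (and $1_k={}_01_k$); ${}_n(\cdot)_m$ acts on arrow terms by ${}_n({}_k\theta_l)_m={}_{n+k}\theta_{l+m}$ and ${}_n(g\circ f)_m={}_ng_m\circ{}_nf_m$; and $f+g={}_mg\circ f_k$ for $f:n\to m$, $g:k\to l$. Equality of arrows is the smallest congruence (for composition and for ${}_n(\cdot)_m$, with associativity of composition) that satisfies, for all arrow terms $f:n\to m$: $f\circ 1_n=f=1_m\circ f$, ${}_11=1_1$; ${}_{q+r}\theta\circ\xi_{r+k}=\xi_{r+l}\circ{}_{p+r}\theta$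 for $\xi:p\to q$, $\theta:k\to l$ among the symbols $\nabla^i,\Delta^i,!^i,\bar{!}^i$; $f\circ\nabla^n=\nabla^m\circ(f+f)$, $\Delta^m\circ f=(f+f)\circ\Delta^n$, $f\circ{!^n}={!^m}$, $\bar{!}^m\circ f=\bar{!}^n$; $\nabla^k\circ{}_k!^k=1_k=\nabla^k\circ{!^k_k}$, $\nabla^{k+l}\circ({}_k!^l+{!^k_l})=1_{k+l}$; ${}_k\bar{!}^k\circ\Delta^k=1_k=\bar{!}^k_k\circ\Delta^k$, $({}_k\bar{!}^l+\bar{!}^k_l)\circ\Delta^{k+l}=1_{k+l}$; $!^0=\bar{!}^0=1_0$; and *generalized bialgebraic separability* $\nabla^k\circ\Delta^k=1_k$. $\mathit{Rel}$ is the category of binary relations between finite ordinals, with the usual composition. Each arrow term $f:n\to m$ of $\mathcal{RB}_{\mathrm I}$ has an associated relation $Gf\subseteq n\times m$: ${}_n1_m$ gives the identity; ${}_n\nabla^k_m$ relates $i$ to $i$ for $i<n+k$ and $i$ to $i-k$ for $i\ge n+k$; ${}_n\Delta^k_m$ gives the converse relation; ${}_n!^k_m$ relates $i$ to $i$ for $i<n$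 and $i$ to $i+k$ for $i\ge n$; ${}_n\bar{!}^k_m$ gives the converse relation; composition gives composition of relations. For arrow terms $f,g:n\to m$ let $f\cup g=\nabla^m\circ(f+g)\circ\Delta^n$ and $0^{n,m}={!^m}\circ\bar{!}^n$ (the empty union). For $i<n$, $j<m$ the *iota term* is $\binom ij^{n,m}=0^{i,j}+1_1+0^{n-i-1,m-j-1}: n\to m$. **Theorem.** 1. $\mathcal{RB}$ is the relational bialgebraic monad freely generated by the single object $0$: for every relational bialgebraic monad on a category $\mathcal A$ and every object $a$ of $\mathcal A$ there is exactly one functor $F:\mathcal{RB}\to\mathcal A$ with $F0=a$ that strictly preserves $M,\nabla,\Delta,!,\bar{!},\tau$. 2. In $\mathcal{RB}_{\mathrm I}$ the object $0$ is a null object and $n+m$, with injections ${}_n!^m$, ${!^n_m}$ and projections ${}_n\bar{!}^m$, $\bar{!}^n_m$, is a biproduct of $n$ and $m$, with $f+g$ as its action on arrows; it is strictified (the associativity isomorphisms of the biproduct and its isomorphisms with the null object are identity arrows). $\nabla^n$ and $\Delta^n$ are its codiagonal and diagonal, and $\nabla^n\circ\Delta^n=1_n$. 3. The categories $\mathcal{RB}$,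 $\mathcal{RB}_{\mathrm I}$ and $\mathit{Rel}$ are isomorphic. More precisely, there are isomorphisms of categories $K:\mathcal{RB}\to\mathcal{RB}_{\mathrm I}$ and $G:\mathcal{RB}_{\mathrm I}\to\mathit{Rel}$, both identity on objects, such that $K(Mf)={}_1(Kf)$, $K$ sends the components at $n$ of $\nabla,\Delta,!,\bar{!},\tau$ to $\nabla^1_n$, $\Delta^1_n$, $!^1_n$, $\bar{!}^1_n$ and $(\nabla^2\circ({!^1_1}+{}_1!^1))_n$, and $G$ sends the arrow designated by a term $f$ to the relation $Gf$. 4. (Iota normal form.) Every arrow term $f:n\to m$ of $\mathcal{RB}_{\mathrm I}$ is equal in $\mathcal{RB}_{\mathrm I}$ to a (possibly empty) union of iota terms without repetitions, and $f$ is equal in $\mathcal{RB}_{\mathrm I}$ to a union of iota terms $\binom ij^{n,m}$, $(i,j)\in L$, if and only if the set of pairs that occur in the list $L$ is the relation $Gf$. -/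

import Mathlib

open CategoryTheory CategoryTheory.Limits

universe v u v' u'

/-! ### Relational bialgebraic monads

Composition `f ≫ g` is in diagrammatic order. For a natural transformation `θ` and an endofunctor
`M`, the component at `X` of `M θ` is `M.map (θ.app X)`, and that of `θ_M` is `θ.app (M.obj X)`. -/

/-- A commutative bialgebraic monad on `C`: an endofunctor `M` with a monad structure
`(M, ∇, !) = (toFunctor, μ, η)`, a comonad structure `(M, Δ, ¡) = (toFunctor, δ, ε)` and a
self-inverse symmetry `τ`, subject to the Yang-Baxter equation, the symmetrization equations and the
four bialgebraic homomorphism equations. -/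
structure CommBialgMonad (C : Type u) [Category.{v} C] extends Monad C where
  /-- the comultiplication `Δ` -/
  δ : toFunctor ⟶ toFunctor ⋙ toFunctor
  /-- the counit `¡` -/
  ε : toFunctor ⟶ 𝟭 C
  coassoc : ∀ X, δ.app X ≫ toFunctor.map (δ.app X) = δ.app X ≫ δ.app (toFunctor.obj X)
  left_counit : ∀ X, δ.app X ≫ ε.app (toFunctor.obj X) = 𝟙 (toFunctor.obj X)
  right_counit : ∀ X, δ.app X ≫ toFunctor.map (ε.app X) = 𝟙 (toFunctor.obj X)
  /-- the symmetry `τ` -/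
  τ : toFunctor ⋙ toFunctor ⟶ toFunctor ⋙ toFunctor
  τ_τ : ∀ X, τ.app X ≫ τ.app X = 𝟙 (toFunctor.obj (toFunctor.obj X))
  yang_baxter : ∀ X,
    toFunctor.map (τ.app X) ≫ τ.app (toFunctor.obj X) ≫ toFunctor.map (τ.app X) =
      τ.app (toFunctor.obj X) ≫ toFunctor.map (τ.app X) ≫ τ.app (toFunctor.obj X)
  τ_mul : ∀ X, τ.app X ≫ μ.app X = μ.app X
  comul_τ : ∀ X, δ.app X ≫ τ.app X = δ.app X
  mul_symm : ∀ X, μ.app (toFunctor.obj X) ≫ τ.app X =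
    toFunctor.map (τ.app X) ≫ τ.app (toFunctor.obj X) ≫ toFunctor.map (μ.app X)
  comul_symm : ∀ X, τ.app X ≫ δ.app (toFunctor.obj X) =
    toFunctor.map (δ.app X) ≫ τ.app (toFunctor.obj X) ≫ toFunctor.map (τ.app X)
  unit_symm : ∀ X, η.app (toFunctor.obj X) ≫ τ.app X = toFunctor.map (η.app X)
  counit_symm : ∀ X, τ.app X ≫ ε.app (toFunctor.obj X) = toFunctor.map (ε.app X)
  unit_counit : ∀ X, η.app X ≫ ε.app X = 𝟙 X
  mul_counit : ∀ X, μ.app X ≫ ε.app X = toFunctor.map (ε.app X) ≫ ε.app X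
  unit_comul : ∀ X, η.app X ≫ δ.app X = η.app X ≫ toFunctor.map (η.app X)
  mul_comul : ∀ X, μ.app X ≫ δ.app X =
    δ.app (toFunctor.obj X) ≫
      toFunctor.map (toFunctor.map (δ.app X)) ≫
      toFunctor.map (τ.app (toFunctor.obj X)) ≫
      μ.app (toFunctor.obj (toFunctor.obj X)) ≫
      toFunctor.map (μ.app X)

/-- A relational bialgebraic monad: a commutative bialgebraic monad with `∇ ∘ Δ = 1`. -/
structure RelBialgMonad (C : Type u) [Category.{v} C] extends CommBialgMonad C where
  separable : ∀ X, δ.app X ≫ μ.app X = 𝟙 (toFunctor.obj X)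

/-- The comonad that underlies a commutative bialgebraic monad. -/
def CommBialgMonad.toComonad {C : Type u} [Category.{v} C] (B : CommBialgMonad C) : Comonad C where
  toFunctor := B.toFunctor
  ε := B.ε
  δ := B.δ
  coassoc := B.coassoc
  left_counit := B.left_counit
  right_counit := B.right_counit

/-- `F` strictly preserves the structure of relational bialgebraic monads. -/
structure RelBialgMonad.IsStrictHom {C : Type u} [Category.{v} C] {D : Type u'} [Category.{v'} D]
    (B : RelBialgMonad C) (B' : RelBialgMonad D) (F : C ⥤ D) : Prop where
  comm : B.toFunctor ⋙ F = F ⋙ B'.toFunctor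
  map_mul : ∀ X, HEq (F.map (B.μ.app X)) (B'.μ.app (F.obj X))
  map_comul : ∀ X, HEq (F.map (B.δ.app X)) (B'.δ.app (F.obj X))
  map_unit : ∀ X, HEq (F.map (B.η.app X)) (B'.η.app (F.obj X))
  map_counit : ∀ X, HEq (F.map (B.ε.app X)) (B'.ε.app (F.obj X))
  map_symm : ∀ X, HEq (F.map (B.τ.app X)) (B'.τ.app (F.obj X))

/-! ### The category `RB`

The syntactic relational bialgebraic monad on one generating object `0`. The object `M ⋯ M 0` with
`n` occurrences of `M` is the number `n`. -/

/-- Objects of `RB`. -/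
structure RB : Type where
  /-- the object `Mⁿ 0` -/
  of ::
  /-- the number of occurrences of `M` -/
  val : ℕ

namespace RB

/-- Arrow terms of `RB`; the argument of `mul`, `comul`, `unit`, `counit`, `symm` is the object at
which the component of `∇`, `Δ`, `!`, `¡`, `τ` is taken. -/
inductive Term : ℕ → ℕ → Type
  | ident (n : ℕ) : Term n n
  | comp {a b c : ℕ} (g : Term b c) (f : Term a b) : Term a c
  | map {a b : ℕ} (f : Term a b) : Term (a + 1) (b + 1)
  | mul (n : ℕ) : Term (n + 2) (n + 1)
  | comul (n : ℕ) : Term (n + 1) (n + 2)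
  | unit (n : ℕ) : Term n (n + 1)
  | counit (n : ℕ) : Term (n + 1) n
  | symm (n : ℕ) : Term (n + 2) (n + 2)

open Term in
/-- The equations of `RB`: the congruence generated by the equations of a category, of an
endofunctor, of natural transformations and of a relational bialgebraic monad. -/
inductive Eqv : ∀ {a b : ℕ}, Term a b → Term a b → Prop
  | refl {a b : ℕ} (f : Term a b) : Eqv f f
  | symm {a b : ℕ} {f g : Term a b} : Eqv f g → Eqv g f
  | trans {a b : ℕ} {f g h : Term a b} : Eqv f g → Eqv g h → Eqv f h
  | comp_congr {a b c : ℕ} {g g' : Term b c} {f f' : Term a b} :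
      Eqv g g' → Eqv f f' → Eqv (comp g f) (comp g' f')
  | map_congr {a b : ℕ} {f f' : Term a b} : Eqv f f' → Eqv (map f) (map f')
  -- category and endofunctor
  | id_comp {a b : ℕ} (f : Term a b) : Eqv (comp f (ident a)) f
  | comp_id {a b : ℕ} (f : Term a b) : Eqv (comp (ident b) f) f
  | assoc {a b c d : ℕ} (h : Term c d) (g : Term b c) (f : Term a b) :
      Eqv (comp (comp h g) f) (comp h (comp g f))
  | map_id (n : ℕ) : Eqv (map (ident n)) (ident (n + 1))
  | map_comp {a b c : ℕ} (g : Term b c) (f : Term a b) :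
      Eqv (map (comp g f)) (comp (map g) (map f))
  -- naturality
  | mul_nat {a b : ℕ} (f : Term a b) :
      Eqv (comp (mul b) (map (map f))) (comp (map f) (mul a))
  | comul_nat {a b : ℕ} (f : Term a b) :
      Eqv (comp (comul b) (map f)) (comp (map (map f)) (comul a))
  | unit_nat {a b : ℕ} (f : Term a b) : Eqv (comp (unit b) f) (comp (map f) (unit a))
  | counit_nat {a b : ℕ} (f : Term a b) : Eqv (comp (counit b) (map f)) (comp f (counit a))
  | symm_nat {a b : ℕ} (f : Term a b) :
      Eqv (comp (symm b) (map (map f))) (comp (map (map f)) (symm a))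
  -- monad
  | mul_assoc (n : ℕ) : Eqv (comp (mul n) (mul (n + 1))) (comp (mul n) (map (mul n)))
  | unit_mul (n : ℕ) : Eqv (comp (mul n) (unit (n + 1))) (ident (n + 1))
  | mul_unit (n : ℕ) : Eqv (comp (mul n) (map (unit n))) (ident (n + 1))
  -- comonad
  | comul_assoc (n : ℕ) :
      Eqv (comp (comul (n + 1)) (comul n)) (comp (map (comul n)) (comul n))
  | counit_comul (n : ℕ) : Eqv (comp (counit (n + 1)) (comul n)) (ident (n + 1))
  | comul_counit (n : ℕ) : Eqv (comp (map (counit n)) (comul n)) (ident (n + 1))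
  -- symmetry
  | symm_symm (n : ℕ) : Eqv (comp (symm n) (symm n)) (ident (n + 2))
  | yang_baxter (n : ℕ) :
      Eqv (comp (map (symm n)) (comp (symm (n + 1)) (map (symm n))))
        (comp (symm (n + 1)) (comp (map (symm n)) (symm (n + 1))))
  | mul_comm (n : ℕ) : Eqv (comp (mul n) (symm n)) (mul n)
  | comul_comm (n : ℕ) : Eqv (comp (symm n) (comul n)) (comul n)
  | mul_symm (n : ℕ) :
      Eqv (comp (symm n) (mul (n + 1)))
        (comp (map (mul n)) (comp (symm (n + 1)) (map (symm n))))
  | comul_symm (n : ℕ) :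
      Eqv (comp (comul (n + 1)) (symm n))
        (comp (map (symm n)) (comp (symm (n + 1)) (map (comul n))))
  | unit_symm (n : ℕ) : Eqv (comp (symm n) (unit (n + 1))) (map (unit n))
  | counit_symm (n : ℕ) : Eqv (comp (counit (n + 1)) (symm n)) (map (counit n))
  -- bialgebraic homomorphism equations
  | unit_counit (n : ℕ) : Eqv (comp (counit n) (unit n)) (ident n)
  | mul_counit (n : ℕ) : Eqv (comp (counit n) (mul n)) (comp (counit n) (map (counit n)))
  | unit_comul (n : ℕ) : Eqv (comp (comul n) (unit n)) (comp (map (unit n)) (unit n))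
  | mul_comul (n : ℕ) :
      Eqv (comp (comul n) (mul n))
        (comp (map (mul n)) (comp (mul (n + 2)) (comp (map (symm (n + 1)))
          (comp (map (map (comul n))) (comul (n + 1))))))
  -- separability
  | separable (n : ℕ) : Eqv (comp (mul n) (comul n)) (ident (n + 1))

/-- Equality of arrow terms in `RB`. -/
instance setoid (a b : ℕ) : Setoid (Term a b) where
  r := Eqv
  iseqv := ⟨Eqv.refl, Eqv.symm, Eqv.trans⟩

instance : Category RB where
  Hom X Y := Quotient (setoid X.val Y.val)
  id X := ⟦Term.ident X.val⟧
  comp f g := Quotient.map₂ (fun f g => Term.comp g f)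
    (fun _ _ hf _ _ hg => Eqv.comp_congr hg hf) f g
  id_comp f := Quotient.inductionOn f fun f => Quotient.sound (Eqv.id_comp f)
  comp_id f := Quotient.inductionOn f fun f => Quotient.sound (Eqv.comp_id f)
  assoc f g h := Quotient.inductionOn₃ f g h fun f g h => Quotient.sound (Eqv.assoc h g f).symm

/-- The arrow of `RB` designated by an arrow term. -/
def arrow {a b : ℕ} (f : Term a b) : (RB.of a ⟶ RB.of b) := Quotient.mk (setoid a b) f

/-- The endofunctor `M` of `RB`. -/
def functor : RB ⥤ RB where
  obj X := ⟨X.val + 1⟩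
  map f := Quotient.map Term.map (fun _ _ h => Eqv.map_congr h) f
  map_id X := Quotient.sound (Eqv.map_id X.val)
  map_comp f g := Quotient.inductionOn₂ f g fun f g => Quotient.sound (Eqv.map_comp g f)

/-- The relational bialgebraic monad on `RB`. -/
def monad : RelBialgMonad RB where
  toFunctor := functor
  η := { app := fun X => arrow (.unit X.val)
         naturality := fun _ _ f => Quotient.inductionOn f fun f => Quotient.sound (Eqv.unit_nat f) }
  μ := { app := fun X => arrow (.mul X.val)
         naturality := fun _ _ f => Quotient.inductionOn f fun f => Quotient.sound (Eqv.mul_nat f) }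
  δ := { app := fun X => arrow (.comul X.val)
         naturality := fun _ _ f =>
          Quotient.inductionOn f fun f => Quotient.sound (Eqv.comul_nat f) }
  ε := { app := fun X => arrow (.counit X.val)
         naturality := fun _ _ f =>
          Quotient.inductionOn f fun f => Quotient.sound (Eqv.counit_nat f) }
  τ := { app := fun X => arrow (.symm X.val)
         naturality := fun _ _ f =>
          Quotient.inductionOn f fun f => Quotient.sound (Eqv.symm_nat f) }
  assoc X := Quotient.sound (Eqv.mul_assoc X.val).symm
  left_unit X := Quotient.sound (Eqv.unit_mul X.val)
  right_unit X := Quotient.sound (Eqv.mul_unit X.val)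
  coassoc X := Quotient.sound (Eqv.comul_assoc X.val).symm
  left_counit X := Quotient.sound (Eqv.counit_comul X.val)
  right_counit X := Quotient.sound (Eqv.comul_counit X.val)
  τ_τ X := Quotient.sound (Eqv.symm_symm X.val)
  yang_baxter X := Quotient.sound
    ((Eqv.assoc _ _ _).trans (Eqv.yang_baxter X.val) |>.trans (Eqv.assoc _ _ _).symm)
  τ_mul X := Quotient.sound (Eqv.mul_comm X.val)
  comul_τ X := Quotient.sound (Eqv.comul_comm X.val)
  mul_symm X := Quotient.sound ((Eqv.mul_symm X.val).trans (Eqv.assoc _ _ _).symm)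
  comul_symm X := Quotient.sound ((Eqv.comul_symm X.val).trans (Eqv.assoc _ _ _).symm)
  unit_symm X := Quotient.sound (Eqv.unit_symm X.val)
  counit_symm X := Quotient.sound (Eqv.counit_symm X.val)
  unit_counit X := Quotient.sound (Eqv.unit_counit X.val)
  mul_counit X := Quotient.sound (Eqv.mul_counit X.val)
  unit_comul X := Quotient.sound (Eqv.unit_comul X.val)
  mul_comul X := Quotient.sound <| (Eqv.mul_comul X.val).trans <| Eqv.symm <|
    (Eqv.assoc _ _ _).trans <| (Eqv.assoc _ _ _).trans <| (Eqv.assoc _ _ _).trans <|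
      (Eqv.refl _)
  separable X := Quotient.sound (Eqv.separable X.val)

end RB

/-! ### The category `RB_I` -/

/-- Objects of `RB_I`: the finite ordinals. -/
structure RBI : Type where
  /-- the object `n` -/
  of ::
  /-- the finite ordinal -/
  val : ℕ

namespace RBI

/-- The symbols `∇ᵏ : k + k → k`, `Δᵏ : k → k + k`, `!ᵏ : 0 → k` and `¡ᵏ : k → 0`. -/
inductive Prim : Type
  | nabla (k : ℕ)
  | delta (k : ℕ)
  | bang (k : ℕ)
  | cobang (k : ℕ)

/-- The source of a symbol. -/
def Prim.src : Prim → ℕ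
  | nabla k => k + k
  | delta k => k
  | bang _ => 0
  | cobang k => k

/-- The target of a symbol. -/
def Prim.tgt : Prim → ℕ
  | nabla k => k
  | delta k => k + k
  | bang k => k
  | cobang _ => 0

/-- Arrow terms of `RB_I`. The primitive ones are `one n m`, for `ₙ1ₘ`, and `prim n θ m`, for `ₙθₘ`.
The source and the target are arbitrary numbers that are equal to the displayed ones. -/
inductive Term : ℕ → ℕ → Type
  | one (n m : ℕ) {s t : ℕ} (hs : s = n + m := by simp) (ht : t = n + m := by simp) : Term s t
  | prim (n : ℕ) (θ : Prim) (m : ℕ) {s t : ℕ}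
      (hs : s = n + θ.src + m := by simp [Prim.src])
      (ht : t = n + θ.tgt + m := by simp [Prim.tgt]) : Term s t
  | comp {a b c : ℕ} (g : Term b c) (f : Term a b) : Term a c

namespace Term

/-- The arrow term `ₙfₘ`. -/
def whisk (n m : ℕ) : {a b : ℕ} → Term a b → {s t : ℕ} →
    (s = n + a + m) → (t = n + b + m) → Term s t
  | _, _, one p q h h', _, _, hs, ht => one (n + p) (q + m) (by omega) (by omega)
  | _, _, prim p θ q h h', _, _, hs, ht => prim (n + p) θ (q + m) (by omega) (by omega)
  | _, _, comp g f, _, _, hs, ht => comp (whisk n m g rfl ht) (whisk n m f hs rfl)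

/-- For `f : n → m` and `g : k → l`, the arrow term `f + g = ₘg ∘ fₖ : n + k → m + l`. -/
def add {n m k l : ℕ} (f : Term n m) (g : Term k l) {s t : ℕ}
    (hs : s = n + k := by rfl) (ht : t = m + l := by rfl) : Term s t :=
  comp (whisk m 0 g (s := m + k) rfl ht) (whisk 0 k f (by omega) (by omega))

/-- The identity `1ₙ = ₀1ₙ`. -/
def ident (n : ℕ) : Term n n := one 0 n

/-- The arrow term `∇ⁿ`. -/
def nabla (n : ℕ) : Term (n + n) n := prim 0 (.nabla n) 0

/-- The arrow term `Δⁿ`. -/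
def delta (n : ℕ) : Term n (n + n) := prim 0 (.delta n) 0

/-- The arrow term `!ⁿ`. -/
def bang (n : ℕ) : Term 0 n := prim 0 (.bang n) 0

/-- The arrow term `¡ⁿ`. -/
def cobang (n : ℕ) : Term n 0 := prim 0 (.cobang n) 0

/-- The first injection `ₙ!ᵐ : n → n + m`. -/
def inl (n m : ℕ) : Term n (n + m) := prim n (.bang m) 0

/-- The second injection `!ⁿₘ : m → n + m`. -/
def inr (n m : ℕ) : Term m (n + m) := prim 0 (.bang n) m

/-- The first projection `ₙ¡ᵐ : n + m → n`. -/
def fst (n m : ℕ) : Term (n + m) n := prim n (.cobang m) 0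

/-- The second projection `¡ⁿₘ : n + m → m`. -/
def snd (n m : ℕ) : Term (n + m) m := prim 0 (.cobang n) m

end Term

open Term in
/-- The equations of `RB_I`. -/
inductive Eqv : ∀ {a b : ℕ}, Term a b → Term a b → Prop
  | refl {a b : ℕ} (f : Term a b) : Eqv f f
  | symm {a b : ℕ} {f g : Term a b} : Eqv f g → Eqv g f
  | trans {a b : ℕ} {f g h : Term a b} : Eqv f g → Eqv g h → Eqv f h
  | comp_congr {a b c : ℕ} {g g' : Term b c} {f f' : Term a b} :
      Eqv g g' → Eqv f f' → Eqv (comp g f) (comp g' f')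
  | whisk_congr (n m : ℕ) {a b : ℕ} {f g : Term a b} {s t : ℕ}
      (hs : s = n + a + m) (ht : t = n + b + m) :
      Eqv f g → Eqv (whisk n m f hs ht) (whisk n m g hs ht)
  | assoc {a b c d : ℕ} (h : Term c d) (g : Term b c) (f : Term a b) :
      Eqv (comp (comp h g) f) (comp h (comp g f))
  | id_comp {a b : ℕ} (f : Term a b) : Eqv (comp f (ident a)) f
  | comp_id {a b : ℕ} (f : Term a b) : Eqv (comp (ident b) f) f
  -- `₁1₀ = ₀1₁`
  | fun_one : Eqv (one 1 0 : Term 1 1) (ident 1)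
  -- for symbols `ξ : p → q` and `θ : k → l`, the equation `_{q+r}θ ∘ ξ_{r+k} = ξ_{r+l} ∘ _{p+r}θ`
  | fl (ξ θ : Prim) (r : ℕ) :
      Eqv
        (comp (prim (ξ.tgt + r) θ 0 rfl rfl : Term (ξ.tgt + r + θ.src) (ξ.tgt + r + θ.tgt))
          (prim 0 ξ (r + θ.src) (by omega) (by omega) : Term (ξ.src + r + θ.src) _))
        (comp (prim 0 ξ (r + θ.tgt) (by omega) (by omega))
          (prim (ξ.src + r) θ 0 rfl rfl : Term _ (ξ.src + r + θ.tgt)))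
  -- naturality
  | nabla_nat {n m : ℕ} (f : Term n m) :
      Eqv (comp f (nabla n)) (comp (nabla m) (add f f))
  | delta_nat {n m : ℕ} (f : Term n m) :
      Eqv (comp (delta m) f) (comp (add f f) (delta n))
  | bang_nat {n m : ℕ} (f : Term n m) : Eqv (comp f (bang n)) (bang m)
  | cobang_nat {n m : ℕ} (f : Term n m) : Eqv (comp (cobang m) f) (cobang n)
  -- triangular equations
  | nabla_bang_one (k : ℕ) : Eqv (comp (nabla k) (prim k (.bang k) 0)) (ident k)
  | nabla_bang_two (k : ℕ) : Eqv (comp (nabla k) (prim 0 (.bang k) k)) (ident k)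
  | nabla_bang (k l : ℕ) :
      Eqv (comp (nabla (k + l)) (add (inl k l) (inr k l))) (ident (k + l))
  | delta_cobang_one (k : ℕ) : Eqv (comp (prim k (.cobang k) 0) (delta k)) (ident k)
  | delta_cobang_two (k : ℕ) : Eqv (comp (prim 0 (.cobang k) k) (delta k)) (ident k)
  | delta_cobang (k l : ℕ) :
      Eqv (comp (add (fst k l) (snd k l)) (delta (k + l))) (ident (k + l))
  -- null object
  | bang_zero : Eqv (bang 0) (ident 0)
  | cobang_zero : Eqv (cobang 0) (ident 0)
  -- generalized bialgebraic separability
  | nabla_delta (k : ℕ) : Eqv (comp (nabla k) (delta k)) (ident k)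

/-- Equality of arrow terms in `RB_I`. -/
instance setoid (a b : ℕ) : Setoid (Term a b) where
  r := Eqv
  iseqv := ⟨Eqv.refl, Eqv.symm, Eqv.trans⟩

instance : Category RBI where
  Hom X Y := Quotient (setoid X.val Y.val)
  id X := ⟦Term.ident X.val⟧
  comp f g := Quotient.map₂ (fun f g => Term.comp g f)
    (fun _ _ hf _ _ hg => Eqv.comp_congr hg hf) f g
  id_comp f := Quotient.inductionOn f fun f => Quotient.sound (Eqv.id_comp f)
  comp_id f := Quotient.inductionOn f fun f => Quotient.sound (Eqv.comp_id f)
  assoc f g h := Quotient.inductionOn₃ f g h fun f g h => Quotient.sound (Eqv.assoc h g f).symm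

/-- The arrow of `RB_I` designated by an arrow term. -/
def arrow {a b : ℕ} (f : Term a b) : (RBI.of a ⟶ RBI.of b) := Quotient.mk (setoid a b) f

/-- The sum of objects. -/
def sumObj (X Y : RBI) : RBI := ⟨X.val + Y.val⟩

/-- The sum of arrows. -/
def sumMap {X Y X' Y' : RBI} (f : X ⟶ Y) (g : X' ⟶ Y') : sumObj X X' ⟶ sumObj Y Y' :=
  Quotient.map₂ (fun (f : Term X.val Y.val) (g : Term X'.val Y'.val) => Term.add f g)
    (fun _ _ hf _ _ hg => Eqv.comp_congr (Eqv.whisk_congr _ _ _ _ hg)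
      (Eqv.whisk_congr _ _ _ _ hf)) f g

end RBI

/-- `z` is a null object and `add`, with the given injections, projections and action `sum` on
arrows, is a binary biproduct, strictified: the associativity isomorphisms of the biproduct and its
isomorphisms with the null object are identity arrows. -/
structure IsStrictBiproduct {C : Type u} [Category.{v} C] (z : C) (add : C → C → C)
    (inl : ∀ a b, a ⟶ add a b) (inr : ∀ a b, b ⟶ add a b)
    (fst : ∀ a b, add a b ⟶ a) (snd : ∀ a b, add a b ⟶ b)
    (sum : ∀ {a b a' b' : C}, (a ⟶ b) → (a' ⟶ b') → (add a a' ⟶ add b b')) : Prop where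
  isZero : IsZero z
  coproduct : ∀ a b, Nonempty (IsColimit (BinaryCofan.mk (inl a b) (inr a b)))
  product : ∀ a b, Nonempty (IsLimit (BinaryFan.mk (fst a b) (snd a b)))
  inl_fst : ∀ a b, inl a b ≫ fst a b = 𝟙 a
  inr_snd : ∀ a b, inr a b ≫ snd a b = 𝟙 b
  inl_snd : ∀ a b, inl a b ≫ snd a b = isZero.from_ a ≫ isZero.to_ b
  inr_fst : ∀ a b, inr a b ≫ fst a b = isZero.from_ b ≫ isZero.to_ a
  inl_sum : ∀ {a b a' b' : C} (f : a ⟶ b) (g : a' ⟶ b'), inl a a' ≫ sum f g = f ≫ inl b b'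
  inr_sum : ∀ {a b a' b' : C} (f : a ⟶ b) (g : a' ⟶ b'), inr a a' ≫ sum f g = g ≫ inr b b'
  sum_fst : ∀ {a b a' b' : C} (f : a ⟶ b) (g : a' ⟶ b'), sum f g ≫ fst b b' = fst a a' ≫ f
  sum_snd : ∀ {a b a' b' : C} (f : a ⟶ b) (g : a' ⟶ b'), sum f g ≫ snd b b' = snd a a' ≫ g
  add_assoc : ∀ a b c, add (add a b) c = add a (add b c)
  add_zero : ∀ a, add a z = a
  zero_add : ∀ a, add z a = a
  inl_assoc : ∀ a b c, HEq (inl a b ≫ inl (add a b) c) (inl a (add b c))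
  mid_assoc : ∀ a b c, HEq (inr a b ≫ inl (add a b) c) (inl b c ≫ inr a (add b c))
  inr_assoc : ∀ a b c, HEq (inr (add a b) c) (inr b c ≫ inr a (add b c))
  fst_assoc : ∀ a b c, HEq (fst (add a b) c ≫ fst a b) (fst a (add b c))
  fst_snd_assoc : ∀ a b c, HEq (fst (add a b) c ≫ snd a b) (snd a (add b c) ≫ fst b c)
  snd_assoc : ∀ a b c, HEq (snd (add a b) c) (snd a (add b c) ≫ snd b c)
  inl_zero : ∀ a, HEq (inl a z) (𝟙 a)
  inr_zero : ∀ a, HEq (inr z a) (𝟙 a)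
  fst_zero : ∀ a, HEq (fst a z) (𝟙 a)
  snd_zero : ∀ a, HEq (snd z a) (𝟙 a)

/-- The arrow term of `RB_I` that translates an arrow term of `RB`: `M f = ₁f`, the components at
`n` of `∇`, `Δ`, `!`, `¡` are `∇¹ₙ`, `Δ¹ₙ`, `!¹ₙ`, `¡¹ₙ`, and that of `τ` is
`(∇² ∘ (!¹₁ + ₁!¹))ₙ`. -/
def RB.Term.translate : {a b : ℕ} → RB.Term a b → RBI.Term a b
  | _, _, .ident n => RBI.Term.ident n
  | _, _, .comp g f => RBI.Term.comp g.translate f.translate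
  | _, _, .map f => RBI.Term.whisk 1 0 f.translate (by omega) (by omega)
  | _, _, .mul n => RBI.Term.whisk 0 n (RBI.Term.nabla 1) (by omega) (by omega)
  | _, _, .comul n => RBI.Term.whisk 0 n (RBI.Term.delta 1) (by omega) (by omega)
  | _, _, .unit n => RBI.Term.whisk 0 n (RBI.Term.bang 1) (by omega) (by omega)
  | _, _, .counit n => RBI.Term.whisk 0 n (RBI.Term.cobang 1) (by omega) (by omega)
  | _, _, .symm n =>
    RBI.Term.whisk 0 n
      (RBI.Term.comp (RBI.Term.nabla 2) (RBI.Term.add (RBI.Term.inr 1 1) (RBI.Term.inl 1 1)))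
      (by omega) (by omega)

/-! ### The category `Rel` -/

/-- Objects of `Rel`: the finite ordinals `n = {0, …, n - 1}`. -/
structure RelOrd : Type where
  /-- the object `n` -/
  of ::
  /-- the finite ordinal -/
  val : ℕ

/-- Arrows of `Rel`: binary relations, with the usual composition of relations. -/
instance : Category RelOrd where
  Hom X Y := SetRel (Fin X.val) (Fin Y.val)
  id _ := SetRel.id
  comp R S := SetRel.comp R S
  id_comp := SetRel.id_comp
  comp_id := SetRel.comp_id
  assoc := SetRel.comp_assoc

namespace RBI.Term

/-- The binary relation that an arrow term of `RB_I` stands for. -/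
def rel : {a b : ℕ} → Term a b → SetRel (Fin a) (Fin b)
  | _, _, one _ _ _ _ => {p | p.1.val = p.2.val}
  | _, _, prim n (.nabla k) _ _ _ =>
    {p | (p.1.val < n + k ∧ p.2.val = p.1.val) ∨ (n + k ≤ p.1.val ∧ p.2.val + k = p.1.val)}
  | _, _, prim n (.delta k) _ _ _ =>
    {p | (p.2.val < n + k ∧ p.1.val = p.2.val) ∨ (n + k ≤ p.2.val ∧ p.1.val + k = p.2.val)}
  | _, _, prim n (.bang k) _ _ _ =>
    {p | (p.1.val < n ∧ p.2.val = p.1.val) ∨ (n ≤ p.1.val ∧ p.2.val = p.1.val + k)}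
  | _, _, prim n (.cobang k) _ _ _ =>
    {p | (p.2.val < n ∧ p.1.val = p.2.val) ∨ (n ≤ p.2.val ∧ p.1.val = p.2.val + k)}
  | _, _, comp g f => SetRel.comp (rel f) (rel g)

/-- The union `f ∪ g = ∇ᵐ ∘ (f + g) ∘ Δⁿ` of arrow terms `f, g : n → m`. -/
def union {n m : ℕ} (f g : Term n m) : Term n m := comp (nabla m) (comp (add f g) (delta n))

/-- The zero term `0^{n,m} = !ᵐ ∘ ¡ⁿ : n → m`. -/
def zero (n m : ℕ) : Term n m := comp (bang m) (cobang n)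

/-- The iota term `0^{i,j} + 1₁ + 0^{n-i-1,m-j-1} : n → m`, for `p = (i, j)`. -/
def iota {n m : ℕ} (p : Fin n × Fin m) : Term n m :=
  add (add (zero p.1.val p.2.val) (ident 1)) (zero (n - p.1.val - 1) (m - p.2.val - 1))
    (by omega) (by omega)

/-- The union of a list of iota terms; the empty union is the zero term. -/
def iotaUnion {n m : ℕ} : List (Fin n × Fin m) → Term n m
  | [] => zero n m
  | [p] => iota p
  | p :: q :: L => union (iota p) (iotaUnion (q :: L))

end RBI.Term

/-!
The proof compares both syntactic categories with `Rel`.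

Every arrow term `f : a → b` of `RB_I` acts on predicates, that is on sets of numbers, by direct image
under its relation (`RBI.Term.act`). Extended by a shift beyond the last target, this action is
blind to whiskering on the right, and that makes it easy to check the equations of `RB_I`
(`RBI.Eqv.act_eq`) and, through the translation, those of `RB` (`RB.Eqv.act_eq`).

Conversely, arrow terms with the same action are equal. In `RB_I`, the equations give finite products
and coproducts directly. A predicate `S` defines an arrow `vector m S : 1 → m` as an iterated pairing
of the scalars `1₁` and `0^{1,1}`; naturality of `∇` and `Δ`, and separability for `1₁ ∪ 1₁ = 1₁`,
show that an arrow term sends the vector of `S` to the vector of the image of `S` (`vector_comp`). As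
vectors are jointly epimorphic, the action determines the arrow (`RBI.arrow_eq_of_act`).

In `RB` there are no sums of arrows at hand, and a normal form takes their place. A predicate `S`
defines an arrow `absorb n S : M Mⁿ 0 → Mⁿ 0` that is the identity on `Mⁿ 0` and sends the new point to
`S`. In any relational bialgebraic monad, such arrows can be extended from `X` to `M X`, with or without
the point of `M X` in the image (`RelBialgMonad.extend`), and the lemmas `extend_*` say that this
is compatible with the components of the structure. Hence each arrow term `f` satisfies
`f ∘ absorb S = absorb (f S) ∘ M f` (`RB.absorb_arrow`). The normal form of a relation `R : n → m` is the
composite of the arrows `absorb m (R i)` for `i < n`, starting from the arrow `0 → m`. It follows that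
post-composition with `f` sends the normal form of `R` to that of the image of `R` under `f`; since the
identity is in normal form, so is every arrow (`RB.normal_arrow`, `RB.normal_eq`). The same normal forms
give an arrow for each relation (`RB.exists_act`).

So `RB → RB_I → Rel` are isomorphisms, the coherence of the biproduct and the iota normal form become
computations with relations, and the universal property of `RB` is an induction on arrow terms.
-/

/-! ### The action of arrow terms of `RB_I` on predicates -/

namespace RBI.Term

/-- The direct image of a predicate under the relation of an arrow term `f : a → b`. Predicates are
on all natural numbers: beyond its targets, `f` acts as the shift that sends `a + r` to `b + r`. With
this convention `fₘ` acts in the same way as `f`. -/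
def act : {a b : ℕ} → Term a b → (ℕ → Prop) → ℕ → Prop
  | _, _, one _ _ _ _, S => S
  | _, _, prim n (.nabla k) _ _ _, S => fun j =>
    if j < n then S j else if j < n + k then S j ∨ S (j + k) else S (j + k)
  | _, _, prim n (.delta k) _ _ _, S => fun j => if j < n + k then S j else S (j - k)
  | _, _, prim n (.bang k) _ _ _, S => fun j =>
    if j < n then S j else if j < n + k then False else S (j - k)
  | _, _, prim n (.cobang k) _ _ _, S => fun j => if j < n then S j else S (j + k)
  | _, _, comp g f, S => act g (act f S)

theorem act_of_le {a b : ℕ} (f : Term a b) (S : ℕ → Prop) {j : ℕ} (hj : b ≤ j) :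
    act f S j = S (j - b + a) := by
  induction f generalizing S j with
  | one n m hs ht => simp only [act]; congr 1; omega
  | prim n θ m hs ht =>
    cases θ <;> simp only [act] <;> simp only [Prim.src, Prim.tgt] at hs ht
    · rw [if_neg (by omega), if_neg (by omega)]; congr 1; omega
    · rw [if_neg (by omega)]; congr 1; omega
    · rw [if_neg (by omega), if_neg (by omega)]; congr 1; omega
    · rw [if_neg (by omega)]; congr 1; omega
  | comp g f ihg ihf =>
    rw [act, ihg _ hj, ihf _ (by omega)]; congr 1; omega

/-- Below its target, an arrow term acts by direct image under its relation. -/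
theorem act_iff_rel {a b : ℕ} (f : Term a b) (S : ℕ → Prop) (j : Fin b) :
    act f S j ↔ ∃ i : Fin a, S i ∧ (i, j) ∈ f.rel := by
  induction f generalizing S with
  | one n m hs ht =>
    simp only [act, rel, Set.mem_ofPred_eq]
    refine ⟨fun h => ⟨⟨j, by omega⟩, h, rfl⟩, ?_⟩
    rintro ⟨i, hi, h⟩
    rwa [← h]
  | prim n θ m hs ht =>
    cases θ with
    | nabla k =>
      simp only [Prim.src, Prim.tgt] at hs ht
      simp only [act, rel, Set.mem_ofPred_eq]
      have hj := j.2
      constructor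
      · intro h
        split_ifs at h with h1 h2
        · exact ⟨⟨j, by omega⟩, h, Or.inl ⟨by simp only; omega, rfl⟩⟩
        · rcases h with h | h
          · exact ⟨⟨j, by omega⟩, h, Or.inl ⟨by simp only; omega, rfl⟩⟩
          · exact ⟨⟨j + k, by omega⟩, h, Or.inr ⟨by simp only; omega, rfl⟩⟩
        · exact ⟨⟨j + k, by omega⟩, h, Or.inr ⟨by simp only; omega, rfl⟩⟩
      · rintro ⟨i, hi, ⟨h, e⟩ | ⟨h, e⟩⟩
        · rw [e]
          split_ifs
          exacts [hi, Or.inl hi]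
        · rw [e, if_neg (by omega)]
          split_ifs
          exacts [Or.inr hi, hi]
    | delta k =>
      simp only [Prim.src, Prim.tgt] at hs ht
      simp only [act, rel, Set.mem_ofPred_eq]
      have hj := j.2
      constructor
      · intro h
        split_ifs at h with h1
        · exact ⟨⟨j, by omega⟩, h, Or.inl ⟨h1, rfl⟩⟩
        · exact ⟨⟨j - k, by omega⟩, h, Or.inr ⟨by omega, by simp only; omega⟩⟩
      · rintro ⟨i, hi, ⟨h, e⟩ | ⟨h, e⟩⟩
        · rwa [if_pos h, ← e]
        · rwa [if_neg (by omega), ← e, Nat.add_sub_cancel]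
    | bang k =>
      simp only [Prim.src, Prim.tgt] at hs ht
      simp only [act, rel, Set.mem_ofPred_eq]
      have hj := j.2
      constructor
      · intro h
        split_ifs at h with h1 h2
        · exact ⟨⟨j, by omega⟩, h, Or.inl ⟨h1, rfl⟩⟩
        · exact ⟨⟨j - k, by omega⟩, h, Or.inr ⟨by simp only; omega, by simp only; omega⟩⟩
      · rintro ⟨i, hi, ⟨h, e⟩ | ⟨h, e⟩⟩
        · rwa [e, if_pos h]
        · rwa [e, if_neg (by omega), if_neg (by omega), Nat.add_sub_cancel]
    | cobang k =>
      simp only [Prim.src, Prim.tgt] at hs ht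
      simp only [act, rel, Set.mem_ofPred_eq]
      have hj := j.2
      constructor
      · intro h
        split_ifs at h with h1
        · exact ⟨⟨j, by omega⟩, h, Or.inl ⟨h1, rfl⟩⟩
        · exact ⟨⟨j + k, by omega⟩, h, Or.inr ⟨by omega, rfl⟩⟩
      · rintro ⟨i, hi, ⟨h, e⟩ | ⟨h, e⟩⟩
        · rwa [if_pos h, ← e]
        · rwa [if_neg (by omega), ← e]
  | comp g f ihg ihf =>
    simp only [act, ihg, ihf, rel, SetRel.mem_comp]
    constructor
    · rintro ⟨k, ⟨i, hi, h⟩, h'⟩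
      exact ⟨i, hi, k, h, h'⟩
    · rintro ⟨i, hi, k, h, h'⟩
      exact ⟨k, ⟨i, hi, h⟩, h'⟩

theorem mem_rel {a b : ℕ} (f : Term a b) (i : Fin a) (j : Fin b) :
    (i, j) ∈ f.rel ↔ act f (fun k => k = i) j := by
  rw [act_iff_rel]
  refine ⟨fun h => ⟨i, rfl, h⟩, ?_⟩
  rintro ⟨k, hk, h⟩
  rwa [← Fin.ext hk]

/-- Two arrow terms act in the same way if and only if they have the same relation. -/
theorem act_eq_iff {a b : ℕ} {f g : Term a b} : act f = act g ↔ f.rel = g.rel := by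
  constructor
  · intro h
    ext ⟨i, j⟩
    rw [mem_rel, mem_rel, h]
  · intro h
    funext S j
    rcases lt_or_ge j b with hj | hj
    · have hf := act_iff_rel f S ⟨j, hj⟩
      rw [h, ← act_iff_rel] at hf
      exact propext hf
    · rw [act_of_le f S hj, act_of_le g S hj]

theorem act_congr {a b : ℕ} (f : Term a b) {S T : ℕ → Prop} (h : ∀ i < a, (S i ↔ T i)) {j : ℕ}
    (hj : j < b) : act f S j = act f T j := by
  apply propext
  rw [act_iff_rel f S ⟨j, hj⟩, act_iff_rel f T ⟨j, hj⟩]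
  simp only [h _ (Fin.is_lt _)]

theorem act_or {a b : ℕ} (f : Term a b) (S T : ℕ → Prop) (j : ℕ) :
    act f (fun i => S i ∨ T i) j = (act f S j ∨ act f T j) := by
  rcases lt_or_ge j b with hj | hj
  · apply propext
    rw [act_iff_rel f _ ⟨j, hj⟩, act_iff_rel f S ⟨j, hj⟩, act_iff_rel f T ⟨j, hj⟩]
    simp only [or_and_right, exists_or]
  · simp only [act_of_le f _ hj]

theorem act_false {a b : ℕ} (f : Term a b) {S : ℕ → Prop} (hS : ∀ i < a, ¬ S i) {j : ℕ}
    (hj : j < b) : ¬ act f S j := by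
  rw [act_iff_rel f S ⟨j, hj⟩]
  rintro ⟨i, hi, -⟩
  exact hS i i.2 hi

theorem act_whisk (n m : ℕ) {a b : ℕ} (f : Term a b) {s t : ℕ} (hs : s = n + a + m)
    (ht : t = n + b + m) (S : ℕ → Prop) (j : ℕ) :
    act (whisk n m f hs ht) S j = if j < n then S j else act f (fun i => S (i + n)) (j - n) := by
  induction f generalizing s t S j with
  | one p q h h' =>
    simp only [whisk, act]
    split_ifs with h
    · rfl
    · rw [Nat.sub_add_cancel (by omega)]
  | prim p θ q h h' =>
    have e1 : ∀ k, ¬ j < n → j - n + k + n = j + k := by omega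
    have e2 : ∀ k, ¬ j < n → j - n < k → j < n + k := by omega
    cases θ <;> simp only [whisk, act] <;> split_ifs <;> first | omega | rfl | skip
    all_goals
      first
      | rw [Nat.sub_add_cancel (by omega), e1 _ (by assumption)]
      | rw [e1 _ (by assumption)]
      | rw [Nat.sub_add_cancel (by omega)]
      | (congr 1; omega)
  | comp g f ihg ihf =>
    simp only [whisk, act, ihg, ihf]
    split_ifs with h
    · rfl
    · congr 1
      funext i
      rw [if_neg (by omega), Nat.add_sub_cancel]

theorem act_add {n m k l : ℕ} (f : Term n m) (g : Term k l) {s t : ℕ} (hs : s = n + k)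
    (ht : t = m + l) (S : ℕ → Prop) (j : ℕ) :
    act (add f g hs ht) S j =
      if j < m then act f S j else act g (fun i => S (i + n)) (j - m) := by
  have e : act (whisk 0 k f (s := s) (t := m + k) (by omega) (by omega)) S = act f S := by
    funext j
    simp [act_whisk]
  rw [add, act, e, act_whisk]
  congr 2
  funext i
  rw [act_of_le f S (by omega), Nat.add_sub_cancel]

theorem act_prim (n : ℕ) (θ : Prim) (m : ℕ) {s t : ℕ} (hs : s = n + θ.src + m)
    (ht : t = n + θ.tgt + m) :
    act (prim n θ m hs ht) = act (whisk n m (prim 0 θ 0 (by omega) (by omega)) hs ht) := by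
  cases θ <;> rfl

theorem act_ident (n : ℕ) (S : ℕ → Prop) : act (ident n) S = S := rfl

theorem act_comp {a b c : ℕ} (g : Term b c) (f : Term a b) (S : ℕ → Prop) :
    act (comp g f) S = act g (act f S) := rfl

theorem act_nabla (n : ℕ) (S : ℕ → Prop) (j : ℕ) :
    act (nabla n) S j = if j < n then S j ∨ S (j + n) else S (j + n) := by
  simp [act, nabla]

theorem act_delta (n : ℕ) (S : ℕ → Prop) (j : ℕ) :
    act (delta n) S j = if j < n then S j else S (j - n) := by
  simp [act, delta]

theorem act_bang (n : ℕ) (S : ℕ → Prop) (j : ℕ) :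
    act (bang n) S j = if j < n then False else S (j - n) := by
  simp [act, bang]

theorem act_cobang (n : ℕ) (S : ℕ → Prop) (j : ℕ) : act (cobang n) S j = S (j + n) := by
  simp [act, cobang]

end RBI.Term

open RBI.Term in
/-- The equations of `RB_I` hold for the action, and so for relations. -/
theorem RBI.Eqv.act_eq {a b : ℕ} {f g : Term a b} (h : Eqv f g) : act f = act g := by
  induction h with
  | refl f => rfl
  | symm _ ih => exact ih.symm
  | trans _ _ ih ih' => exact ih.trans ih'
  | comp_congr _ _ ih ih' => funext S; simp only [act, ih, ih']
  | whisk_congr n m hs ht _ ih => funext S j; simp only [act_whisk, ih]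
  | assoc h g f => rfl
  | id_comp f => rfl
  | comp_id f => rfl
  | fun_one => rfl
  | fl ξ θ r =>
    funext S j
    have h0 : ∀ θ : Prim, ∀ m : ℕ, ∀ s t, ∀ hs : s = θ.src + m, ∀ ht : t = θ.tgt + m,
        act (prim 0 θ m (s := s) (t := t) (by omega) (by omega)) =
          act (prim 0 θ 0 (s := θ.src) (t := θ.tgt) (by omega) (by omega)) := by
      intro θ m s t hs ht
      cases θ <;> rfl
    rw [act_comp, act_comp, act_prim (ξ.tgt + r), act_prim (ξ.src + r),
      h0 ξ (r + θ.src) _ _ (by omega) (by omega),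
      h0 ξ (r + θ.tgt) _ _ (by omega) (by omega), act_whisk]
    split_ifs with h
    · rcases lt_or_ge j ξ.tgt with hj | hj
      · refine act_congr _ (fun i hi => ?_) hj
        rw [act_whisk, if_pos (by omega)]
      · rw [act_of_le _ _ hj, act_of_le _ _ hj, act_whisk, if_pos (by omega)]
    · rw [act_of_le _ _ (by omega : ξ.tgt ≤ j), act_whisk, if_neg (by omega)]
      congr 1
      · funext i
        rw [act_of_le _ _ (by omega)]
        congr 1; omega
      · omega
  | @nabla_nat n m f =>
    funext S j
    simp only [act_comp, act_nabla, act_add]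
    split_ifs with h1 h2
    · omega
    · rw [Nat.add_sub_cancel, ← act_or]
      refine act_congr f (fun i hi => ?_) h1
      simp [act_nabla, hi]
    · omega
    · rw [act_of_le f _ (by omega), act_of_le f _ (by omega), act_nabla, if_neg (by omega)]
      congr 1; omega
  | @delta_nat n m f =>
    funext S j
    simp only [act_comp, act_delta, act_add]
    split_ifs with h1
    · exact act_congr f (fun i hi => by simp [act_delta, hi]) h1
    · simp
  | @bang_nat n m f =>
    funext S j
    simp only [act_comp, act_bang]
    split_ifs with h1
    · exact propext ⟨act_false f (fun i hi => by simp [act_bang, hi]) h1, False.elim⟩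
    · rw [act_of_le f _ (by omega), act_bang, if_neg (by omega), Nat.add_sub_cancel]
  | @cobang_nat n m f =>
    funext S j
    rw [act_comp, act_cobang, act_cobang, act_of_le f _ (by omega), Nat.add_sub_cancel]
  | nabla_bang_one k =>
    funext S j
    simp only [act, nabla, ident]
    split_ifs <;> first | omega | simp
  | nabla_bang_two k =>
    funext S j
    simp only [act, nabla, ident]
    split_ifs <;> first | omega | simp
  | nabla_bang k l =>
    funext S j
    simp only [act_comp, act_nabla, act_add]
    simp only [act, inl, inr, ident]
    split_ifs <;> first | omega | simp
    all_goals rw [Nat.sub_add_cancel (by omega)]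
  | delta_cobang_one k =>
    funext S j
    simp only [act, delta, ident]
    split_ifs <;> first | omega | simp
  | delta_cobang_two k =>
    funext S j
    simp only [act, delta, ident]
    split_ifs <;> first | omega | simp
  | delta_cobang k l =>
    funext S j
    simp only [act_comp, act_delta, act_add]
    simp only [act, fst, snd, ident, act_delta]
    split_ifs <;> first | omega | rfl | (congr 1; omega)
  | bang_zero => funext S j; simp [act_bang, ident, act]
  | cobang_zero => funext S j; simp [act_cobang, ident, act]
  | nabla_delta k =>
    funext S j
    simp only [act, nabla, delta, ident]
    split_ifs <;> first | omega | simp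

/-! ### Whiskering and sums in `RB_I` -/

namespace RBI

namespace Term

theorem prim_congr {n n' m m' : ℕ} (θ : Prim) (hn : n = n') (hm : m = m') {s t : ℕ}
    (hs : s = n + θ.src + m) (ht : t = n + θ.tgt + m) :
    prim n θ m hs ht = prim n' θ m' (by omega) (by omega) := by
  subst hn hm; rfl

theorem one_congr {n n' m m' : ℕ} (hn : n = n') (hm : m = m') {s t : ℕ} (hs : s = n + m)
    (ht : t = n + m) : one n m hs ht = one n' m' (by omega) (by omega) := by
  subst hn hm; rfl

theorem whisk_comp (n m : ℕ) {a b c : ℕ} (g : Term b c) (f : Term a b) {s t t' : ℕ}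
    (hs : s = n + a + m) (ht : t = n + b + m) (ht' : t' = n + c + m) :
    whisk n m (comp g f) hs ht' = comp (whisk n m g ht ht') (whisk n m f hs ht) := by
  subst ht; rfl

theorem whisk_zero {a b : ℕ} (f : Term a b) {hs : a = 0 + a + 0} {ht : b = 0 + b + 0} :
    whisk 0 0 f hs ht = f := by
  induction f with
  | one => exact one_congr (by omega) (by omega) _ _
  | prim => exact prim_congr _ (by omega) (by omega) _ _
  | @comp a b c g f ihg ihf =>
    rw [whisk_comp 0 0 g f hs (by omega : b = 0 + b + 0) ht, ihg, ihf]

theorem whisk_whisk (n m p q : ℕ) {a b : ℕ} (f : Term a b) {s t s' t' : ℕ}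
    (hs : s = p + a + q) (ht : t = p + b + q) (hs' : s' = n + s + m) (ht' : t' = n + t + m) :
    whisk n m (whisk p q f hs ht) hs' ht' =
      whisk (n + p) (q + m) f (by omega) (by omega) := by
  induction f generalizing s t s' t' with
  | one => exact one_congr (by omega) (by omega) _ _
  | prim => exact prim_congr _ (by omega) (by omega) _ _
  | comp g f ihg ihf =>
    rw [whisk_comp p q g f hs rfl ht, whisk_comp n m _ _ hs' rfl ht', ihg, ihf]
    exact (whisk_comp _ _ _ _ _ _ _).symm

theorem one_eqv_ident (n m : ℕ) {s : ℕ} (h : s = n + m) : Eqv (one n m h h) (ident s) := by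
  induction n generalizing m with
  | zero =>
    rw [one_congr rfl (by omega : m = s) h h]
    exact Eqv.refl _
  | succ n ih =>
    have e : one (n + 1) m h h = whisk n m (one 1 0 : Term 1 1) (by omega) (by omega) :=
      one_congr (by omega) (by omega) _ _
    rw [e]
    exact (Eqv.whisk_congr n m _ _ Eqv.fun_one).trans (ih (1 + m) (by omega))

theorem whisk_ident (n m : ℕ) {a s : ℕ} (h : s = n + a + m) :
    Eqv (whisk n m (ident a) h h) (ident s) :=
  one_eqv_ident _ _ _

/-- Arrow terms that act on disjoint summands commute. -/
theorem interchange {a b k l : ℕ} (f : Term a b) (g : Term k l) {x y z w : ℕ} (hx : x = a + k)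
    (hy : y = b + k) (hz : z = a + l) (hw : w = b + l) :
    Eqv (comp (whisk b 0 g hy hw) (whisk 0 k f (by omega) (by omega) : Term x y))
      (comp (whisk 0 l f (by omega) (by omega)) (whisk a 0 g hx hz)) := by
  induction f generalizing x y z w with
  | @one p q s t hs ht =>
    obtain rfl : s = t := by omega
    obtain rfl : x = y := by omega
    obtain rfl : z = w := by omega
    exact ((Eqv.comp_congr (Eqv.refl _) (one_eqv_ident _ _ (by omega))).trans
      (Eqv.id_comp _)).trans
      ((Eqv.comp_congr (one_eqv_ident _ _ (by omega)) (Eqv.refl _)).trans (Eqv.comp_id _)).symm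
  | @comp a b' b f₂ f₁ ih₂ ih₁ =>
    rw [whisk_comp 0 k f₂ f₁ (by omega) (rfl : _ = 0 + b' + k) (by omega),
      whisk_comp 0 l f₂ f₁ (by omega) (rfl : _ = 0 + b' + l) (by omega)]
    exact (Eqv.assoc _ _ _).symm.trans <|
      (Eqv.comp_congr (ih₂ (by omega) hy (by omega) hw) (Eqv.refl _)).trans <|
      (Eqv.assoc _ _ _).trans <|
      (Eqv.comp_congr (Eqv.refl _) (ih₁ hx (by omega) hz (by omega))).trans <|
      (Eqv.assoc _ _ _).symm
  | @prim p ξ q s t hs ht =>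
    induction g generalizing x y z w with
    | @one p q k l hk hl =>
      obtain rfl : k = l := by omega
      obtain rfl : x = z := by omega
      obtain rfl : y = w := by omega
      exact ((Eqv.comp_congr (one_eqv_ident _ _ (by omega)) (Eqv.refl _)).trans
        (Eqv.comp_id _)).trans
        ((Eqv.comp_congr (Eqv.refl _) (one_eqv_ident _ _ (by omega))).trans
          (Eqv.id_comp _)).symm
    | @comp k l' l g₂ g₁ ih₂ ih₁ =>
      rw [whisk_comp t 0 g₂ g₁ hy (rfl : _ = t + l' + 0) hw,
        whisk_comp s 0 g₂ g₁ hx (rfl : _ = s + l' + 0) hz]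
      exact (Eqv.assoc _ _ _).trans <|
        (Eqv.comp_congr (Eqv.refl _) (ih₁ hx hy (by omega) (by omega))).trans <|
        (Eqv.assoc _ _ _).symm.trans <|
        (Eqv.comp_congr (ih₂ (by omega) (by omega) hz hw) (Eqv.refl _)).trans <|
        (Eqv.assoc _ _ _)
    | @prim p' θ q' k l hk hl =>
      -- between the two symbols there are `q + p'` strands, and `p` and `q'` strands are outside
      have h := Eqv.whisk_congr p q' (s := x) (t := w) (by omega) (by omega)
        (Eqv.fl ξ θ (q + p'))
      rw [whisk_comp p q' _ _ _ (t := y) (by omega) _,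
        whisk_comp p q' _ _ _ (t := z) (by omega) _] at h
      simp only [whisk] at h ⊢
      rw [prim_congr θ (n := p + (ξ.tgt + (q + p'))) (n' := t + p') (m := 0 + q') (m' := q' + 0)
          (by omega) (by omega),
        prim_congr θ (n := p + (ξ.src + (q + p'))) (n' := s + p') (m := 0 + q') (m' := q' + 0)
          (by omega) (by omega),
        prim_congr ξ (n := p + 0) (n' := 0 + p) (m := q + p' + θ.src + q') (m' := q + k)
          (by omega) (by omega),
        prim_congr ξ (n := p + 0) (n' := 0 + p) (m := q + p' + θ.tgt + q') (m' := q + l)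
          (by omega) (by omega)] at h
      exact h

end Term

open Term

theorem arrow_eq {a b : ℕ} {f g : Term a b} (h : Eqv f g) : arrow f = arrow g := Quotient.sound h

theorem arrow_comp {a b c : ℕ} (g : Term b c) (f : Term a b) :
    arrow (comp g f) = arrow f ≫ arrow g := rfl

theorem arrow_ident (n : ℕ) : arrow (ident n) = 𝟙 (of n) := rfl

theorem arrow_surjective {a b : ℕ} (f : of a ⟶ of b) : ∃ f' : Term a b, arrow f' = f :=
  Quotient.exists_rep f

/-- The sum of arrows between ordinals. -/
def plus {n m k l : ℕ} (f : of n ⟶ of m) (g : of k ⟶ of l) : of (n + k) ⟶ of (m + l) :=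
  sumMap f g

theorem arrow_add {n m k l : ℕ} (f : Term n m) (g : Term k l) :
    arrow (add f g) = plus (arrow f) (arrow g) := rfl

theorem plus_comp {n m p k l q : ℕ} (f : of n ⟶ of m) (g : of k ⟶ of l) (f' : of m ⟶ of p)
    (g' : of l ⟶ of q) : plus f g ≫ plus f' g' = plus (f ≫ f') (g ≫ g') := by
  obtain ⟨f, rfl⟩ := arrow_surjective f
  obtain ⟨g, rfl⟩ := arrow_surjective g
  obtain ⟨f', rfl⟩ := arrow_surjective f'
  obtain ⟨g', rfl⟩ := arrow_surjective g'
  simp only [← arrow_add, ← arrow_comp, add]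
  rw [whisk_comp p 0 g' g rfl rfl rfl, whisk_comp 0 k f' f (t := m + k) (by omega) (by omega)
    (by omega)]
  simp only [arrow_comp, Category.assoc]
  have h := arrow_eq (interchange f' g (rfl : m + k = _) rfl rfl rfl)
  simp only [arrow_comp] at h
  rw [← reassoc_of% h]

theorem plus_id_right {n m : ℕ} (f : Term n m) (k : ℕ) {hs : n + k = 0 + n + k}
    {ht : m + k = 0 + m + k} : plus (arrow f) (𝟙 (of k)) = arrow (whisk 0 k f hs ht) := by
  rw [← arrow_ident, ← arrow_add, add, arrow_comp, arrow_eq (whisk_ident m 0 rfl), arrow_ident]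
  exact Category.comp_id _

theorem plus_id_left (n : ℕ) {k l : ℕ} (f : Term k l) :
    plus (𝟙 (of n)) (arrow f) = arrow (whisk n 0 f rfl rfl) := by
  rw [← arrow_ident, ← arrow_add, add, arrow_comp, arrow_eq (whisk_ident 0 k (by omega)),
    arrow_ident]
  exact Category.id_comp _

theorem plus_id (n k : ℕ) : plus (𝟙 (of n)) (𝟙 (of k)) = 𝟙 (of (n + k)) := by
  rw [← arrow_ident k, plus_id_left]
  exact arrow_eq (whisk_ident _ _ _)

theorem plus_id_zero {n m : ℕ} (f : of n ⟶ of m) : plus f (𝟙 (of 0)) = f := by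
  obtain ⟨f, rfl⟩ := arrow_surjective f
  rw [plus_id_right f 0 (hs := by omega) (ht := by omega)]
  exact congrArg arrow (whisk_zero f)

theorem arrow_whisk (n m : ℕ) {a b : ℕ} (f : Term a b) :
    arrow (whisk n m f rfl rfl) = plus (plus (𝟙 (of n)) (arrow f)) (𝟙 (of m)) := by
  rw [plus_id_left, plus_id_right _ m (hs := by omega) (ht := by omega), whisk_whisk]
  congr 1
  congr 1 <;> omega

/-! ### Biproducts in `RB_I` -/

theorem comp_cobang {n m : ℕ} (f : of n ⟶ of m) : f ≫ arrow (cobang m) = arrow (cobang n) := by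
  obtain ⟨f, rfl⟩ := arrow_surjective f
  exact arrow_eq (Eqv.cobang_nat f)

theorem bang_comp {n m : ℕ} (f : of n ⟶ of m) : arrow (bang n) ≫ f = arrow (bang m) := by
  obtain ⟨f, rfl⟩ := arrow_surjective f
  exact arrow_eq (Eqv.bang_nat f)

theorem to_zero_eq {n : ℕ} (f g : of n ⟶ of 0) : f = g := by
  have h : arrow (cobang 0) = 𝟙 (of 0) := arrow_eq Eqv.cobang_zero
  rw [← Category.comp_id f, ← Category.comp_id g, ← h, comp_cobang, comp_cobang]

theorem from_zero_eq {n : ℕ} (f g : of 0 ⟶ of n) : f = g := by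
  have h : arrow (bang 0) = 𝟙 (of 0) := arrow_eq Eqv.bang_zero
  rw [← Category.id_comp f, ← Category.id_comp g, ← h, bang_comp, bang_comp]

theorem comp_zero {n m : ℕ} (f : of n ⟶ of m) (k : ℕ) :
    f ≫ arrow (zero m k) = arrow (zero n k) := by
  rw [zero, arrow_comp, ← Category.assoc, comp_cobang, zero, arrow_comp]

theorem zero_comp (k : ℕ) {n m : ℕ} (f : of n ⟶ of m) :
    arrow (zero k n) ≫ f = arrow (zero k m) := by
  rw [zero, arrow_comp, Category.assoc, bang_comp, zero, arrow_comp]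

theorem delta_natural {n m : ℕ} (f : of n ⟶ of m) :
    f ≫ arrow (delta m) = arrow (delta n) ≫ plus f f := by
  obtain ⟨f, rfl⟩ := arrow_surjective f
  exact arrow_eq (Eqv.delta_nat f)

theorem nabla_natural {n m : ℕ} (f : of n ⟶ of m) :
    arrow (nabla n) ≫ f = plus f f ≫ arrow (nabla m) := by
  obtain ⟨f, rfl⟩ := arrow_surjective f
  exact arrow_eq (Eqv.nabla_nat f)

theorem arrow_fst (n m : ℕ) : arrow (fst n m) = plus (𝟙 (of n)) (arrow (cobang m)) :=
  (plus_id_left n (cobang m)).symm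

theorem plus_fst {n m k l : ℕ} (f : of n ⟶ of m) (g : of k ⟶ of l) :
    plus f g ≫ arrow (fst m l) = arrow (fst n k) ≫ f := by
  rw [arrow_fst, plus_comp, comp_cobang, Category.comp_id, arrow_fst]
  conv_rhs => rw [← plus_id_zero f]
  exact (congrArg₂ plus (Category.id_comp f).symm (Category.comp_id _).symm).trans
    (plus_comp _ _ _ _).symm

theorem plus_snd {n m k l : ℕ} (f : of n ⟶ of m) (g : of k ⟶ of l) :
    plus f g ≫ arrow (snd m l) = arrow (snd n k) ≫ g := by
  have e : ∀ n k, snd n k = whisk 0 k (cobang n) (s := n + k) (t := k) (by omega) (by omega) :=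
    fun n k => prim_congr _ (by omega) (by omega) _ _
  have h : plus f g = plus f (𝟙 _) ≫ plus (𝟙 _) g := by
    rw [plus_comp, Category.comp_id, Category.id_comp]
  obtain ⟨f, rfl⟩ := arrow_surjective f
  obtain ⟨g, rfl⟩ := arrow_surjective g
  rw [h, Category.assoc, plus_id_left, plus_id_right f k (hs := by omega) (ht := by omega), e]
  have h' := arrow_eq (interchange (cobang m) g (rfl : m + k = _) (by omega : k = 0 + k) rfl
    (by omega : l = 0 + l))
  simp only [whisk_zero, arrow_comp] at h'
  rw [← h', ← Category.assoc, ← arrow_comp, ← whisk_comp, e,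
    arrow_eq (Eqv.whisk_congr 0 k _ _ (Eqv.cobang_nat f))]

/-- The pairing of two arrows, for the product `n + m`. -/
def pair {p n m : ℕ} (f : of p ⟶ of n) (g : of p ⟶ of m) : of p ⟶ of (n + m) :=
  arrow (delta p) ≫ plus f g

theorem pair_fst {p n m : ℕ} (f : of p ⟶ of n) (g : of p ⟶ of m) :
    pair f g ≫ arrow (fst n m) = f := by
  have h : arrow (delta p) ≫ arrow (fst p p) = 𝟙 (of p) := arrow_eq (Eqv.delta_cobang_one p)
  rw [pair, Category.assoc, plus_fst, reassoc_of% h]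

theorem pair_snd {p n m : ℕ} (f : of p ⟶ of n) (g : of p ⟶ of m) :
    pair f g ≫ arrow (snd n m) = g := by
  have h : arrow (delta p) ≫ arrow (snd p p) = 𝟙 (of p) := arrow_eq (Eqv.delta_cobang_two p)
  rw [pair, Category.assoc, plus_snd, reassoc_of% h]

theorem pair_plus {p n m k l : ℕ} (f : of p ⟶ of n) (g : of p ⟶ of k) (f' : of n ⟶ of m)
    (g' : of k ⟶ of l) : pair f g ≫ plus f' g' = pair (f ≫ f') (g ≫ g') := by
  rw [pair, Category.assoc, plus_comp, pair]

theorem eq_pair {p n m : ℕ} (h : of p ⟶ of (n + m)) :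
    h = pair (h ≫ arrow (fst n m)) (h ≫ arrow (snd n m)) := by
  have e : arrow (delta (n + m)) ≫ plus (arrow (fst n m)) (arrow (snd n m)) = 𝟙 (of (n + m)) :=
    arrow_eq (Eqv.delta_cobang n m)
  rw [pair, ← plus_comp, ← Category.assoc, ← delta_natural, Category.assoc, e, Category.comp_id]

theorem hom_ext_product {p n m : ℕ} {h h' : of p ⟶ of (n + m)}
    (h₁ : h ≫ arrow (fst n m) = h' ≫ arrow (fst n m))
    (h₂ : h ≫ arrow (snd n m) = h' ≫ arrow (snd n m)) : h = h' := by
  rw [eq_pair h, eq_pair h', h₁, h₂]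

theorem eq_copair {p n m : ℕ} (h : of (n + m) ⟶ of p) :
    h = plus (arrow (inl n m) ≫ h) (arrow (inr n m) ≫ h) ≫ arrow (nabla p) := by
  have e : plus (arrow (inl n m)) (arrow (inr n m)) ≫ arrow (nabla (n + m)) = 𝟙 (of (n + m)) :=
    arrow_eq (Eqv.nabla_bang n m)
  rw [← plus_comp, Category.assoc, ← nabla_natural, ← Category.assoc, e, Category.id_comp]

theorem hom_ext_coproduct {p n m : ℕ} {h h' : of (n + m) ⟶ of p}
    (h₁ : arrow (inl n m) ≫ h = arrow (inl n m) ≫ h')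
    (h₂ : arrow (inr n m) ≫ h = arrow (inr n m) ≫ h') : h = h' := by
  rw [eq_copair h, eq_copair h', h₁, h₂]

theorem comp_pair {q p n m : ℕ} (h : of q ⟶ of p) (f : of p ⟶ of n) (g : of p ⟶ of m) :
    h ≫ pair f g = pair (h ≫ f) (h ≫ g) := by
  rw [pair, ← Category.assoc, delta_natural, Category.assoc, plus_comp, pair]

theorem inl_eq_pair (n m : ℕ) : arrow (inl n m) = pair (𝟙 (of n)) (arrow (zero n m)) := by
  apply hom_ext_product
  · rw [pair_fst, ← arrow_comp]
    have e : comp (fst n m) (inl n m) = whisk n 0 (comp (cobang m) (bang m)) rfl rfl := rfl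
    rw [e, arrow_eq (Eqv.whisk_congr n 0 rfl rfl ((Eqv.bang_nat (cobang m)).trans Eqv.bang_zero)),
      arrow_eq (whisk_ident n 0 rfl)]
    rfl
  · rw [pair_snd, ← arrow_comp]
    have h := arrow_eq (interchange (cobang n) (bang m) (rfl : n = n + 0) rfl (rfl : n + m = _)
      (by omega : m = 0 + m))
    rw [whisk_zero, whisk_zero] at h
    refine Eq.trans ?_ h.symm
    congr 2
    exact prim_congr _ (by omega) (by omega) _ _

theorem inr_eq_pair (n m : ℕ) : arrow (inr n m) = pair (arrow (zero m n)) (𝟙 (of m)) := by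
  have e₁ : inr n m = whisk 0 m (bang n) (s := m) (t := n + m) (by omega) (by omega) :=
    prim_congr _ (by omega) (by omega) _ _
  apply hom_ext_product
  · rw [pair_fst, ← arrow_comp]
    have h := arrow_eq (interchange (bang n) (cobang m) (by omega : m = 0 + m)
      (rfl : n + m = n + m) (by omega : 0 = 0 + 0) (by omega : n = n + 0))
    rw [whisk_zero, whisk_zero] at h
    rw [e₁]
    exact h
  · have e₂ : snd n m = whisk 0 m (cobang n) (s := n + m) (t := m) (by omega) (by omega) :=
      prim_congr _ (by omega) (by omega) _ _
    rw [pair_snd, ← arrow_comp, e₁, e₂, ← whisk_comp,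
      arrow_eq (Eqv.whisk_congr 0 m _ _ ((Eqv.bang_nat (cobang n)).trans Eqv.bang_zero)),
      arrow_eq (whisk_ident 0 m (by omega)), arrow_ident]

theorem pair_zero_zero (p n m : ℕ) :
    pair (arrow (zero p n)) (arrow (zero p m)) = arrow (zero p (n + m)) := by
  rw [eq_pair (arrow (zero p (n + m))), zero_comp, zero_comp]

theorem pair_cobang {p n : ℕ} (f : of p ⟶ of n) : pair f (arrow (cobang p)) = f := by
  have h : arrow (delta p) ≫ arrow (fst p p) = 𝟙 (of p) := arrow_eq (Eqv.delta_cobang_one p)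
  have h' : plus f (arrow (cobang p)) = arrow (fst p p) ≫ f := by
    rw [← plus_fst f (𝟙 (of p)), arrow_fst, plus_comp, Category.comp_id, Category.id_comp]
  rw [pair, h', reassoc_of% h]

theorem pair_assoc_one {p n m : ℕ} (f : of p ⟶ of n) (g : of p ⟶ of m) (h : of p ⟶ of 1) :
    pair (pair f g) h = (pair f (pair g h) : of p ⟶ of (n + (m + 1))) := by
  apply hom_ext_product (n := n) (m := m + 1)
  · have e : arrow (fst (n + m) 1) ≫ arrow (fst n m) = arrow (fst n (m + 1)) := by
      have e' : comp (fst n m) (fst (n + m) 1) =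
        whisk n 0 (comp (cobang m) (whisk m 0 (cobang 1) (s := m + 1) rfl rfl)) rfl rfl := rfl
      rw [← arrow_comp, e', arrow_eq (Eqv.whisk_congr n 0 rfl rfl (Eqv.cobang_nat _))]
      rfl
    rw [pair_fst, ← e]
    exact (Category.assoc _ _ _).symm.trans (by rw [pair_fst, pair_fst])
  · rw [pair_snd]
    apply hom_ext_product
    · rw [pair_fst, Category.assoc, arrow_fst m 1, ← plus_snd (𝟙 (of n))]
      have e : plus (𝟙 (of n)) (plus (𝟙 (of m)) (arrow (cobang 1))) = arrow (fst (n + m) 1) := by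
        rw [plus_id_left m, plus_id_left n]
        rfl
      rw [e]
      exact (Category.assoc _ _ _).symm.trans ((congrArg (· ≫ arrow (snd n m)) (pair_fst _ _)).trans (pair_snd _ _))
    · have e : arrow (snd n (m + 1)) ≫ arrow (snd m 1) = arrow (snd (n + m) 1) := by
        have e₁ : snd m 1 = whisk 0 1 (cobang m) (s := m + 1) (t := 1) (by omega) (by omega) :=
          prim_congr _ (by omega) (by omega) _ _
        have e₂ : snd n (m + 1) =
          whisk 0 1 (snd n m) (s := n + (m + 1)) (t := m + 1) (by omega) (by omega) :=
          prim_congr _ (by omega) (by omega) _ _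
        rw [← arrow_comp, e₁, e₂, ← whisk_comp,
          arrow_eq (Eqv.whisk_congr 0 1 _ _ (Eqv.cobang_nat (snd n m)))]
        exact congrArg arrow (prim_congr _ (by omega) (by omega) _ _)
      rw [pair_snd, Category.assoc, e]
      exact pair_snd _ _

end RBI

/-! ### Equal relations give equal arrows of `RB_I` -/

namespace RBI

open Term

open Classical in
/-- The scalar `1₁` or `0^{1,1}`, according to the truth value. -/
noncomputable def scalar (p : Prop) : of 1 ⟶ of 1 := if p then 𝟙 _ else arrow (zero 1 1)

/-- The arrow `1 → m` that relates `0` to the `j < m` with `S j`. -/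
noncomputable def vector : (m : ℕ) → (ℕ → Prop) → (of 1 ⟶ of m)
  | 0, _ => arrow (cobang 1)
  | m + 1, S => pair (vector m S) (scalar (S m))

theorem vector_congr {m : ℕ} {S T : ℕ → Prop} (h : ∀ j < m, S j = T j) :
    vector m S = vector m T := by
  induction m with
  | zero => rfl
  | succ m ih => rw [vector, vector, ih fun j hj => h j (by omega), h m (by omega)]

theorem vector_false (m : ℕ) : vector m (fun _ => False) = arrow (zero 1 m) := by
  induction m with
  | zero => exact to_zero_eq _ _
  | succ m ih => rw [vector, ih, scalar, if_neg id, pair_zero_zero]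

theorem vector_add (n m : ℕ) (S : ℕ → Prop) :
    vector (n + m) S = pair (vector n S) (vector m fun i => S (i + n)) := by
  induction m with
  | zero => exact (pair_cobang _).symm
  | succ m ih =>
    rw [vector, ← pair_assoc_one, Nat.add_comm m n, ← ih]
    rfl

/-- The codiagonal of a sum is computed componentwise. -/
theorem pair_pair_nabla {p n m : ℕ} (f f' : of p ⟶ of n) (g g' : of p ⟶ of m) :
    pair (pair f g) (pair f' g') ≫ arrow (nabla (n + m)) =
      pair (pair f f' ≫ arrow (nabla n)) (pair g g' ≫ arrow (nabla m)) := by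
  apply hom_ext_product
  · rw [pair_fst, Category.assoc, nabla_natural, ← Category.assoc, pair_plus, pair_fst, pair_fst]
  · rw [pair_snd, Category.assoc, nabla_natural, ← Category.assoc, pair_plus, pair_snd, pair_snd]

/-- Generalized bialgebraic separability enters here, when both scalars are `1₁`. -/
theorem scalar_or (p q : Prop) :
    pair (scalar p) (scalar q) ≫ arrow (nabla 1) = scalar (p ∨ q) := by
  by_cases hp : p <;> by_cases hq : q <;> simp only [scalar, hp, hq, if_true, if_false, or_true,
    or_false]
  · rw [pair, plus_id, Category.comp_id]
    exact arrow_eq (Eqv.nabla_delta 1)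
  · rw [← inl_eq_pair]
    exact arrow_eq (Eqv.nabla_bang_one 1)
  · rw [← inr_eq_pair]
    exact arrow_eq (Eqv.nabla_bang_two 1)
  · rw [pair_zero_zero, zero_comp]

theorem vector_or (m : ℕ) (S T : ℕ → Prop) :
    pair (vector m S) (vector m T) ≫ arrow (nabla m) = vector m fun j => S j ∨ T j := by
  induction m with
  | zero => exact to_zero_eq _ _
  | succ m ih => rw [vector, vector, pair_pair_nabla, ih, scalar_or, vector]

/-- The vector of a predicate is sent to that of its direct image. -/
theorem vector_comp {n m : ℕ} (f : Term n m) (S : ℕ → Prop) :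
    vector n S ≫ arrow f = vector m (act f S) := by
  induction f generalizing S with
  | @one n m s t hs ht =>
    obtain rfl : s = t := by omega
    rw [arrow_eq (one_eqv_ident n m hs), arrow_ident, Category.comp_id, act]
  | comp g f ihg ihf => rw [arrow_comp, ← Category.assoc, ihf, ihg, act]
  | prim n θ m hs ht =>
    subst hs ht
    have h : ∀ S, vector θ.src S ≫ arrow (prim 0 θ 0 : Term θ.src θ.tgt) =
        vector θ.tgt (act (prim 0 θ 0 : Term θ.src θ.tgt) S) := by
      intro S
      cases θ with
      | nabla k =>
        change vector (k + k) S ≫ arrow (nabla k) = vector k (act (nabla k) S)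
        rw [vector_add, vector_or]
        exact vector_congr fun j hj => by rw [act_nabla, if_pos hj]
      | delta k =>
        change vector k S ≫ arrow (delta k) = vector (k + k) (act (delta k) S)
        rw [delta_natural, vector_add]
        refine congrArg₂ pair ?_ ?_
        · exact vector_congr fun j hj => by rw [act_delta, if_pos hj]
        · exact vector_congr fun j hj => by
            rw [act_delta, if_neg (by omega), Nat.add_sub_cancel]
      | bang k =>
        change vector 0 S ≫ arrow (bang k) = vector k (act (bang k) S)
        rw [vector, ← arrow_comp]
        refine (vector_false k).symm.trans (vector_congr fun j hj => ?_)
        rw [act_bang, if_pos hj]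
      | cobang k => exact to_zero_eq (n := 1) _ _
    have e : (prim n θ m rfl rfl : Term _ _) =
        whisk n m (prim 0 θ 0 : Term θ.src θ.tgt) rfl rfl :=
      prim_congr _ (by omega) (by omega) _ _
    rw [e, arrow_whisk, vector_add, vector_add, pair_plus, pair_plus, h, Category.comp_id,
      Category.comp_id, vector_add, vector_add]
    congr 2
    · exact vector_congr fun j hj => by rw [act_whisk, if_pos hj]
    · congr 1
      funext j
      rw [act_whisk, if_neg (by omega), Nat.add_sub_cancel]
    · funext j
      rw [act_whisk, if_neg (by omega), act_of_le _ _ (by omega)]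
      congr 1
      omega

theorem hom_ext_vector {n p : ℕ} {h h' : of n ⟶ of p}
    (e : ∀ S, vector n S ≫ h = vector n S ≫ h') : h = h' := by
  induction n with
  | zero => exact from_zero_eq _ _
  | succ n ih =>
    apply hom_ext_coproduct
    · refine ih fun S => ?_
      have hS : vector n S ≫ arrow (inl n 1) = vector (n + 1) fun j => j < n ∧ S j := by
        rw [inl_eq_pair, comp_pair, Category.comp_id, comp_zero, vector, scalar,
          if_neg (by simp)]
        congr 1
        exact vector_congr fun j hj => by simp [hj]
      rw [← Category.assoc, hS, ← Category.assoc, hS, e]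
    · have hS : arrow (inr n 1) = vector (n + 1) fun j => j = n := by
        rw [inr_eq_pair, vector, scalar, if_pos rfl, ← vector_false]
        congr 1
        exact vector_congr fun j hj => by simp [hj.ne]
      rw [hS, e]

/-- Arrow terms of `RB_I` that act in the same way are equal in `RB_I`. -/
theorem arrow_eq_of_act {n m : ℕ} {f g : Term n m} (h : act f = act g) : arrow f = arrow g :=
  hom_ext_vector fun S => by rw [vector_comp, vector_comp, h]

theorem arrow_eq_iff_act {n m : ℕ} {f g : Term n m} : arrow f = arrow g ↔ act f = act g :=
  ⟨fun h => (Quotient.exact h : Eqv f g).act_eq, arrow_eq_of_act⟩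

theorem arrow_eq_iff_rel {n m : ℕ} {f g : Term n m} : arrow f = arrow g ↔ f.rel = g.rel :=
  arrow_eq_iff_act.trans act_eq_iff

end RBI

/-! ### Relational bialgebraic monads -/

namespace RelBialgMonad

variable {C : Type u} [Category.{v} C] (B : RelBialgMonad C)

theorem μ_nat {X Y : C} (f : X ⟶ Y) :
    B.map (B.map f) ≫ B.μ.app Y = B.μ.app X ≫ B.map f := B.μ.naturality f

theorem δ_nat {X Y : C} (f : X ⟶ Y) :
    B.map f ≫ B.δ.app Y = B.δ.app X ≫ B.map (B.map f) := B.δ.naturality f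

theorem η_nat {X Y : C} (f : X ⟶ Y) : f ≫ B.η.app Y = B.η.app X ≫ B.map f := B.η.naturality f

theorem ε_nat {X Y : C} (f : X ⟶ Y) : B.map f ≫ B.ε.app Y = B.ε.app X ≫ f := B.ε.naturality f

theorem τ_nat {X Y : C} (f : X ⟶ Y) :
    B.map (B.map f) ≫ B.τ.app Y = B.τ.app X ≫ B.map (B.map f) := B.τ.naturality f

theorem map_τ_map_τ (X : C) :
    B.map (B.τ.app X) ≫ B.map (B.τ.app X) = 𝟙 (B.obj (B.obj (B.obj X))) := by
  rw [← B.map_comp, B.τ_τ]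
  exact B.map_id _

theorem map_μ_τ (X : C) : B.map (B.μ.app X) ≫ B.τ.app X =
    B.τ.app (B.obj X) ≫ B.map (B.τ.app X) ≫ B.μ.app (B.obj X) := by
  rw [← Category.comp_id (B.μ.app (B.obj X)), ← B.τ_τ X, reassoc_of% (B.mul_symm X),
    reassoc_of% (B.map_τ_map_τ X), reassoc_of% (B.τ_τ (B.obj X))]

theorem map_η_τ (X : C) : B.map (B.η.app X) ≫ B.τ.app X = B.η.app (B.obj X) := by
  rw [← B.unit_symm, Category.assoc, B.τ_τ, Category.comp_id]

theorem τ_map_ε (X : C) : B.τ.app X ≫ B.map (B.ε.app X) = B.ε.app (B.obj X) := by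
  rw [← B.counit_symm, reassoc_of% (B.τ_τ X)]

theorem yang_baxter' (X : C) :
    B.τ.app (B.obj X) ≫ B.map (B.τ.app X) ≫ B.τ.app (B.obj X) =
      B.map (B.τ.app X) ≫ B.τ.app (B.obj X) ≫ B.map (B.τ.app X) := (B.yang_baxter X).symm

/-- The arrow of `M M X` that adds a copy of the first summand to the second one: it relates `0` to
both `0` and `1`, and everything else to itself. -/
def copy (X : C) : B.obj (B.obj X) ⟶ B.obj (B.obj X) :=
  B.δ.app (B.obj X) ≫ B.map (B.μ.app X)

/-- The arrow of `M M M X` that adds a copy of the first summand to the third one. -/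
def copy₂ (X : C) : B.obj (B.obj (B.obj X)) ⟶ B.obj (B.obj (B.obj X)) :=
  B.τ.app (B.obj X) ≫ B.map (B.copy X) ≫ B.τ.app (B.obj X)

theorem copy_nat {X Y : C} (f : X ⟶ Y) :
    B.map (B.map f) ≫ B.copy Y = B.copy X ≫ B.map (B.map f) := by
  rw [copy, reassoc_of% (B.δ_nat (B.map f)), ← B.map_comp, B.μ_nat, B.map_comp, copy,
    Category.assoc]

theorem map_τ_copy (X : C) :
    B.map (B.τ.app X) ≫ B.copy (B.obj X) = B.copy₂ X ≫ B.map (B.τ.app X) := by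
  have h : B.map (B.map (B.μ.app X)) ≫ B.map (B.τ.app X) =
      B.map (B.τ.app (B.obj X)) ≫ B.map (B.map (B.τ.app X)) ≫ B.map (B.μ.app (B.obj X)) := by
    rw [← B.map_comp, B.map_μ_τ, B.map_comp, B.map_comp]
  rw [copy, copy₂, copy, reassoc_of% (B.δ_nat (B.τ.app X)), B.map_comp]
  simp only [Category.assoc]
  rw [reassoc_of% (B.τ_nat (B.μ.app X)), h, ← reassoc_of% (B.comul_symm (B.obj X)),
    reassoc_of% (B.τ_τ (B.obj X))]

theorem copy₂_eq (X : C) :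
    B.copy₂ X = B.map (B.τ.app X) ≫ B.copy (B.obj X) ≫ B.map (B.τ.app X) := by
  rw [reassoc_of% (B.map_τ_copy X), B.map_τ_map_τ]
  exact (Category.comp_id _).symm

theorem map_τ_copy₂ (X : C) :
    B.map (B.τ.app X) ≫ B.copy₂ X = B.copy (B.obj X) ≫ B.map (B.τ.app X) := by
  rw [copy₂_eq, reassoc_of% (B.map_τ_map_τ X)]

theorem τ_map_copy (X : C) :
    B.τ.app (B.obj X) ≫ B.map (B.copy X) = B.copy₂ X ≫ B.τ.app (B.obj X) := by
  rw [copy₂, Category.assoc, Category.assoc, B.τ_τ, Category.comp_id]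

theorem copy_map_μ (X : C) :
    B.copy (B.obj X) ≫ B.map (B.μ.app X) = B.map (B.μ.app X) ≫ B.copy X := by
  rw [copy, copy, reassoc_of% (B.δ_nat (B.μ.app X)), Category.assoc, ← B.map_comp, ← B.map_comp,
    B.assoc]

/-- Copying is idempotent, by separability. -/
theorem copy_copy (X : C) : B.copy X ≫ B.copy X = B.copy X := by
  have h : B.map (B.δ.app (B.obj X)) ≫ B.map (B.μ.app (B.obj X)) = 𝟙 _ := by
    rw [← B.map_comp, B.separable, B.map_id]
  have h' : B.map (B.map (B.μ.app X)) ≫ B.map (B.μ.app X) =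
      B.map (B.μ.app (B.obj X)) ≫ B.map (B.μ.app X) := by
    rw [← B.map_comp, B.assoc, B.map_comp]
  rw [copy, Category.assoc, reassoc_of% (B.δ_nat (B.μ.app X)), h',
    ← reassoc_of% (B.coassoc (B.obj X)), reassoc_of% h]

theorem copy₂_map_μ (X : C) :
    B.copy₂ X ≫ B.map (B.μ.app X) = B.map (B.μ.app X) ≫ B.copy X := by
  have h : B.map (B.τ.app X) ≫ B.map (B.μ.app X) = B.map (B.μ.app X) := by
    rw [← B.map_comp, B.τ_mul]
  conv_lhs => rw [← h]
  rw [← reassoc_of% (B.map_τ_copy X), B.copy_map_μ, reassoc_of% h]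

/-- Copying to the second and to the third summand is the composite that first makes two copies and
then merges them with these summands. -/
theorem copy_copy₂ (X : C) : B.copy (B.obj X) ≫ B.copy₂ X =
    B.δ.app (B.obj (B.obj X)) ≫ B.δ.app (B.obj (B.obj (B.obj X))) ≫
      B.map (B.map (B.τ.app (B.obj X))) ≫ B.map (B.μ.app (B.obj (B.obj X))) ≫
        B.map (B.map (B.μ.app X)) := by
  have hμτ : B.map (B.μ.app (B.obj X)) ≫ B.map (B.τ.app X) =
      B.map (B.map (B.τ.app X)) ≫ B.map (B.τ.app (B.obj X)) ≫ B.map (B.map (B.μ.app X)) := by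
    rw [← B.map_comp, B.mul_symm, B.map_comp, B.map_comp]
  have hττ' : B.map (B.map (B.τ.app X)) ≫ B.map (B.map (B.τ.app X)) =
      𝟙 (B.obj (B.obj (B.obj (B.obj X)))) := by
    rw [← B.map_comp, B.map_τ_map_τ]
    exact B.map_id _
  have hμτ' : B.map (B.map (B.μ.app (B.obj X))) ≫ B.map (B.τ.app (B.obj X)) =
      B.map (B.τ.app (B.obj (B.obj X))) ≫ B.map (B.map (B.τ.app (B.obj X))) ≫
        B.map (B.μ.app (B.obj (B.obj X))) := by
    rw [← B.map_comp, B.map_μ_τ, B.map_comp, B.map_comp]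
  have hδ : B.δ.app (B.obj (B.obj X)) ≫ B.δ.app (B.obj (B.obj (B.obj X))) ≫
      B.map (B.τ.app (B.obj (B.obj X))) =
      B.δ.app (B.obj (B.obj X)) ≫ B.δ.app (B.obj (B.obj (B.obj X))) := by
    rw [← reassoc_of% (B.coassoc (B.obj (B.obj X))), ← B.map_comp, B.comul_τ, B.coassoc]
  rw [copy₂_eq, copy]
  simp only [Category.assoc]
  rw [hμτ, reassoc_of% (B.δ_nat (B.τ.app X)), reassoc_of% hττ',
    reassoc_of% (B.δ_nat (B.μ.app (B.obj X))), reassoc_of% hμτ', reassoc_of% hδ]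

theorem copy₂_copy (X : C) : B.copy₂ X ≫ B.copy (B.obj X) = B.copy (B.obj X) ≫ B.copy₂ X := by
  have hμτ : B.map (B.map (B.μ.app (B.obj X))) ≫ B.map (B.map (B.τ.app X)) =
      B.map (B.map (B.map (B.τ.app X))) ≫ B.map (B.map (B.τ.app (B.obj X))) ≫
        B.map (B.map (B.map (B.μ.app X))) := by
    simp only [← B.map_comp, B.mul_symm]
  have hττ' : B.map (B.map (B.map (B.τ.app X))) ≫ B.map (B.map (B.map (B.τ.app X))) =
      𝟙 (B.obj (B.obj (B.obj (B.obj (B.obj X))))) := by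
    rw [← B.map_comp, ← B.map_comp, B.map_τ_map_τ]
    exact (congrArg (fun f => B.map f) (B.map_id _)).trans (B.map_id _)
  have hμμ : B.map (B.map (B.map (B.μ.app X))) ≫ B.map (B.μ.app (B.obj X)) =
      B.map (B.μ.app (B.obj (B.obj X))) ≫ B.map (B.map (B.μ.app X)) := by
    rw [← B.map_comp, B.μ_nat]
    exact B.map_comp _ _
  rw [B.copy_copy₂, copy₂_eq, copy]
  simp only [Category.assoc]
  rw [reassoc_of% (B.δ_nat (B.τ.app X)), reassoc_of% (B.δ_nat (B.τ.app X)),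
    reassoc_of% (B.δ_nat (B.μ.app (B.obj X))), reassoc_of% hμτ,
    reassoc_of% (B.δ_nat (B.map (B.τ.app X))), reassoc_of% hττ', hμμ]

theorem copy_map_δ (X : C) : B.copy X ≫ B.map (B.δ.app X) =
    B.map (B.δ.app X) ≫ B.copy (B.obj X) ≫ B.copy₂ X := by
  have h : B.map (B.μ.app X) ≫ B.map (B.δ.app X) =
      B.map (B.δ.app (B.obj X)) ≫ B.map (B.map (B.map (B.δ.app X))) ≫
        B.map (B.map (B.τ.app (B.obj X))) ≫ B.map (B.μ.app (B.obj (B.obj X))) ≫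
          B.map (B.map (B.μ.app X)) := by
    simp only [← B.map_comp, B.mul_comul]
  rw [B.copy_copy₂, copy, Category.assoc, h, reassoc_of% (B.δ_nat (B.δ.app X)),
    reassoc_of% (B.δ_nat (B.map (B.δ.app X))), reassoc_of% (B.coassoc (B.obj X))]

/-! ### Actions on the objects of a relational bialgebraic monad -/

open Classical in
/-- Think of `M X` as the sum of a point and `X`. An arrow `α : M X → X` that is the identity on `X`
is determined by the image of the point, a part of `X`. Then `B.extend p α : M M X → M X` is
determined in the same way by this part of `X`, enlarged by the point of `M X` if `p` holds. -/
noncomputable def extend (p : Prop) {X : C} (α : B.obj X ⟶ X) : B.obj (B.obj X) ⟶ B.obj X :=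
  (if p then B.copy X else 𝟙 _) ≫ B.τ.app X ≫ B.map α

theorem extend_true {X : C} (α : B.obj X ⟶ X) :
    B.extend True α = B.copy X ≫ B.τ.app X ≫ B.map α := by
  rw [extend, if_pos trivial]

theorem extend_false {X : C} (α : B.obj X ⟶ X) : B.extend False α = B.τ.app X ≫ B.map α := by
  rw [extend, if_neg id, Category.id_comp]

theorem extend_map (p : Prop) {X Y : C} {α : B.obj X ⟶ X} {β : B.obj Y ⟶ Y} {f : X ⟶ Y}
    (h : α ≫ f = B.map f ≫ β) : B.extend p α ≫ B.map f = B.map (B.map f) ≫ B.extend p β := by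
  have h₀ : (B.τ.app X ≫ B.map α) ≫ B.map f = B.map (B.map f) ≫ B.τ.app Y ≫ B.map β := by
    rw [Category.assoc, ← B.map_comp, h, B.map_comp, reassoc_of% (B.τ_nat f)]
  by_cases hp : p
  · simp only [hp, extend_true]
    rw [Category.assoc, h₀, reassoc_of% (B.copy_nat f)]
  · simp only [hp, extend_false]
    exact h₀

theorem extend_η {X : C} (α : B.obj X ⟶ X) :
    α ≫ B.η.app X = B.map (B.η.app X) ≫ B.extend False α := by
  rw [extend_false, reassoc_of% (B.map_η_τ X), B.η_nat]

theorem extend_ε (p : Prop) {X : C} (α : B.obj X ⟶ X) :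
    B.extend p α ≫ B.ε.app X = B.map (B.ε.app X) ≫ α := by
  have h₀ : (B.τ.app X ≫ B.map α) ≫ B.ε.app X = B.map (B.ε.app X) ≫ α := by
    rw [Category.assoc, B.ε_nat, reassoc_of% (B.counit_symm X)]
  by_cases hp : p
  · simp only [hp, extend_true]
    have h : B.copy X ≫ B.map (B.ε.app X) = B.map (B.ε.app X) := by
      rw [copy, Category.assoc, ← B.map_comp, B.mul_counit, B.map_comp,
        ← reassoc_of% (B.δ_nat (B.ε.app X)), B.right_counit, Category.comp_id]
    rw [Category.assoc, h₀, reassoc_of% h]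
  · simp only [hp, extend_false]
    exact h₀

theorem map_η_extend_ε (X : C) : B.map (B.η.app X) ≫ B.extend True (B.ε.app X) = 𝟙 _ := by
  rw [extend_true, B.τ_map_ε, copy, Category.assoc, B.ε_nat,
    reassoc_of% (B.left_counit (B.obj X)), B.right_unit]

theorem extend_extend_τ (p q : Prop) {X : C} (α : B.obj X ⟶ X) :
    B.extend p (B.extend q α) ≫ B.τ.app X = B.map (B.τ.app X) ≫ B.extend q (B.extend p α) := by
  -- the case of `True` and `False` follows from the opposite one, since `τ` is self-inverse
  have hFT : B.extend False (B.extend True α) ≫ B.τ.app X =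
      B.map (B.τ.app X) ≫ B.extend True (B.extend False α) := by
    simp only [extend_true, extend_false, B.map_comp, Category.assoc]
    rw [B.τ_nat, reassoc_of% (B.τ_map_copy X), reassoc_of% (B.yang_baxter' X),
      reassoc_of% (B.map_τ_copy X)]
  by_cases hp : p <;> by_cases hq : q <;> simp only [hp, hq]
  · simp only [extend_true, B.map_comp, Category.assoc]
    rw [B.τ_nat, reassoc_of% (B.τ_map_copy X), reassoc_of% (B.yang_baxter' X),
      reassoc_of% (B.map_τ_copy X), reassoc_of% (B.τ_map_copy X), reassoc_of% (B.map_τ_copy₂ X),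
      reassoc_of% (B.copy₂_copy X)]
  · have h : B.extend False (B.extend True α) =
        B.map (B.τ.app X) ≫ B.extend True (B.extend False α) ≫ B.τ.app X := by
      rw [← reassoc_of% hFT, B.τ_τ]
      exact (Category.comp_id _).symm
    rw [h, reassoc_of% (B.map_τ_map_τ X)]
  · exact hFT
  · simp only [extend_false, B.map_comp, Category.assoc]
    rw [B.τ_nat, reassoc_of% (B.yang_baxter' X)]

theorem extend_extend_μ (p q : Prop) {X : C} (α : B.obj X ⟶ X) :
    B.extend p (B.extend q α) ≫ B.μ.app X = B.map (B.μ.app X) ≫ B.extend (p ∨ q) α := by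
  have hTF : B.extend True (B.extend False α) ≫ B.μ.app X =
      B.map (B.μ.app X) ≫ B.extend True α := by
    simp only [extend_true, extend_false, B.map_comp, Category.assoc]
    rw [B.μ_nat, ← reassoc_of% (B.map_μ_τ X), reassoc_of% (B.copy_map_μ X)]
  by_cases hp : p <;> by_cases hq : q <;>
    simp only [hp, hq, or_true, or_false]
  · simp only [extend_true, B.map_comp, Category.assoc]
    rw [B.μ_nat, reassoc_of% (B.τ_map_copy X), ← reassoc_of% (B.map_μ_τ X),
      reassoc_of% (B.copy₂_map_μ X), reassoc_of% (B.copy_map_μ X), reassoc_of% (B.copy_copy X)]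
  · exact hTF
  · have h : B.map (B.τ.app X) ≫ B.map (B.μ.app X) = B.map (B.μ.app X) := by
      rw [← B.map_comp, B.τ_mul]
    rw [← B.τ_mul X, reassoc_of% (B.extend_extend_τ False True α), hTF, reassoc_of% h, B.τ_mul]
  · simp only [extend_false, B.map_comp, Category.assoc]
    rw [B.μ_nat, ← reassoc_of% (B.map_μ_τ X)]

theorem extend_δ (p : Prop) {X : C} (α : B.obj X ⟶ X) :
    B.extend p α ≫ B.δ.app X = B.map (B.δ.app X) ≫ B.extend p (B.extend p α) := by
  by_cases hp : p <;> simp only [hp]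
  · simp only [extend_true, B.map_comp, Category.assoc]
    rw [B.δ_nat, reassoc_of% (B.comul_symm X), reassoc_of% (B.copy_map_δ X),
      reassoc_of% (B.τ_map_copy X)]
  · simp only [extend_false, B.map_comp, Category.assoc]
    rw [B.δ_nat, reassoc_of% (B.comul_symm X)]

end RelBialgMonad

/-! ### Equal relations give equal arrows of `RB` -/

namespace RB

open Term

section Act

variable {a b : ℕ} (S : ℕ → Prop) (n j : ℕ)

theorem act_ident : (ident n).translate.act S = S := rfl

theorem act_comp {c : ℕ} (g : Term b c) (f : Term a b) :
    (comp g f).translate.act S = g.translate.act (f.translate.act S) := rfl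

theorem act_map_zero (f : Term a b) : (map f).translate.act S 0 = S 0 := by
  simp [RB.Term.translate, RBI.Term.act_whisk]

theorem act_map_succ (f : Term a b) :
    (map f).translate.act S (j + 1) = f.translate.act (fun i => S (i + 1)) j := by
  simp [RB.Term.translate, RBI.Term.act_whisk]

theorem act_mul_zero : (mul n).translate.act S 0 = (S 0 ∨ S 1) := by
  simp [RB.Term.translate, RBI.Term.act_whisk, RBI.Term.act_nabla]

theorem act_mul_succ : (mul n).translate.act S (j + 1) = S (j + 2) := by
  simp [RB.Term.translate, RBI.Term.act_whisk, RBI.Term.act_nabla]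

theorem act_comul_zero : (comul n).translate.act S 0 = S 0 := by
  simp [RB.Term.translate, RBI.Term.act_whisk, RBI.Term.act_delta]

theorem act_comul_succ : (comul n).translate.act S (j + 1) = S j := by
  simp [RB.Term.translate, RBI.Term.act_whisk, RBI.Term.act_delta]

theorem act_unit_zero : (unit n).translate.act S 0 = False := by
  simp [RB.Term.translate, RBI.Term.act_whisk, RBI.Term.act_bang]

theorem act_unit_succ : (unit n).translate.act S (j + 1) = S j := by
  simp [RB.Term.translate, RBI.Term.act_whisk, RBI.Term.act_bang]

theorem act_counit : (counit n).translate.act S = fun j => S (j + 1) := by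
  funext j
  simp [RB.Term.translate, RBI.Term.act_whisk, RBI.Term.act_cobang]

theorem act_symm_zero : (symm n).translate.act S 0 = S 1 := by
  simp [RB.Term.translate, RBI.Term.act_whisk, RBI.Term.act_nabla, RBI.Term.act_add,
    RBI.Term.inl, RBI.Term.inr, RBI.Term.act]

theorem act_symm_one : (symm n).translate.act S 1 = S 0 := by
  simp [RB.Term.translate, RBI.Term.act_whisk, RBI.Term.act_nabla, RBI.Term.act_add,
    RBI.Term.inl, RBI.Term.inr, RBI.Term.act]

theorem act_symm_add_two : (symm n).translate.act S (j + 2) = S (j + 2) := by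
  simp [RB.Term.translate, RBI.Term.act_whisk, RBI.Term.act_nabla, RBI.Term.act_add,
    RBI.Term.inl, RBI.Term.inr, RBI.Term.act]

end Act

/-- The equations of `RB` hold for relations. -/
theorem Eqv.act_eq {a b : ℕ} {f g : Term a b} (h : Eqv f g) :
    f.translate.act = g.translate.act := by
  induction h with
  | refl f => rfl
  | symm _ ih => exact ih.symm
  | trans _ _ ih ih' => exact ih.trans ih'
  | comp_congr _ _ ih ih' => funext S; simp only [act_comp, ih, ih']
  | map_congr _ ih =>
    funext S j
    rcases j with _ | j <;> simp only [act_map_zero, act_map_succ, ih]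
  | _ =>
    funext S j
    rcases j with _ | _ | _ | j <;>
      simp only [act_comp, act_ident, act_map_zero, act_map_succ, act_mul_zero, act_mul_succ,
        act_comul_zero, act_comul_succ, act_unit_zero, act_unit_succ, act_counit, act_symm_zero,
        act_symm_one, act_symm_add_two, or_comm, or_assoc, false_or, or_self, zero_add, Nat.reduceAdd, Nat.add_assoc]

theorem arrow_eq {a b : ℕ} {f g : Term a b} (h : Eqv f g) : arrow f = arrow g := Quotient.sound h

theorem arrow_comp {a b c : ℕ} (g : Term b c) (f : Term a b) :
    arrow (comp g f) = arrow f ≫ arrow g := rfl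

theorem arrow_ident (n : ℕ) : arrow (ident n) = 𝟙 (of n) := rfl

theorem arrow_surjective {a b : ℕ} (f : of a ⟶ of b) : ∃ f' : Term a b, arrow f' = f :=
  Quotient.exists_rep f

/-- The arrow `M f`, with its source and target as numbers. -/
def shift {a b : ℕ} (f : of a ⟶ of b) : of (a + 1) ⟶ of (b + 1) := monad.map f

theorem shift_comp {a b c : ℕ} (f : of a ⟶ of b) (g : of b ⟶ of c) :
    shift (f ≫ g) = shift f ≫ shift g := monad.map_comp f g

/-- `RelBialgMonad.extend`, with sources and targets as numbers. -/
noncomputable def extend (p : Prop) {n : ℕ} (α : of (n + 1) ⟶ of n) : of (n + 2) ⟶ of (n + 1) :=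
  monad.extend (X := of n) p α

/-- The arrow `Mⁿ⁺¹ 0 → Mⁿ 0` that is the identity on `Mⁿ 0` and relates the new point to the
`j < n` with `S j`. -/
noncomputable def absorb : (n : ℕ) → (ℕ → Prop) → (of (n + 1) ⟶ of n)
  | 0, _ => arrow (counit 0)
  | n + 1, S => extend (S 0) (absorb n fun j => S (j + 1))

/-- Every arrow of `RB` commutes with the arrows that absorb a point. -/
theorem absorb_arrow {a b : ℕ} (f : Term a b) (S : ℕ → Prop) :
    absorb a S ≫ arrow f = shift (arrow f) ≫ absorb b (f.translate.act S) := by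
  induction f generalizing S with
  | ident n =>
    have h : shift (arrow (ident n)) = 𝟙 (of (n + 1)) := monad.map_id (of n)
    rw [h, arrow_ident, Category.comp_id, Category.id_comp, act_ident]
  | comp g f ihg ihf =>
    rw [arrow_comp, ← Category.assoc, ihf, Category.assoc, ihg, ← Category.assoc, ← shift_comp,
      act_comp]
  | @map a b f ih =>
    have h := monad.extend_map (S 0) (ih fun j => S (j + 1))
    simp only [absorb, act_map_zero, act_map_succ]
    exact h
  | mul n =>
    have h := monad.extend_extend_μ (S 0) (S 1) (absorb n fun j => S (j + 2))
    simp only [absorb, act_mul_zero, act_mul_succ]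
    exact h
  | comul n =>
    have h := monad.extend_δ (S 0) (absorb n fun j => S (j + 1))
    simp only [absorb, act_comul_zero, act_comul_succ]
    exact h
  | unit n =>
    have h := monad.extend_η (absorb n S)
    simp only [absorb, act_unit_zero, act_unit_succ]
    exact h
  | counit n =>
    have h := monad.extend_ε (S 0) (absorb n fun j => S (j + 1))
    simp only [absorb, act_counit]
    exact h
  | symm n =>
    have h := monad.extend_extend_τ (S 0) (S 1) (absorb n fun j => S (j + 2))
    simp only [absorb, act_symm_zero, zero_add, act_symm_one, act_symm_add_two, Nat.add_assoc,
      Nat.reduceAdd]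
    exact h

theorem absorb_false (n : ℕ) : absorb n (fun _ => False) = arrow (counit n) := by
  induction n with
  | zero => rfl
  | succ n ih =>
    rw [absorb, ih]
    exact (monad.extend_false _).trans (monad.τ_map_ε (of n))

/-- The arrow `0 → Mⁿ 0`. -/
def initial : (n : ℕ) → (of 0 ⟶ of n)
  | 0 => 𝟙 _
  | n + 1 => initial n ≫ arrow (unit n)

theorem initial_arrow {a b : ℕ} (f : Term a b) : initial a ≫ arrow f = initial b := by
  induction f with
  | ident n => exact Category.comp_id _
  | comp g f ihg ihf => rw [arrow_comp, ← Category.assoc, ihf, ihg]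
  | map f ih =>
    rw [initial, initial, ← ih, Category.assoc, Category.assoc, ← arrow_comp, ← arrow_comp,
      arrow_eq (Eqv.unit_nat f)]
  | mul n =>
    rw [initial, Category.assoc, ← arrow_comp, arrow_eq (Eqv.unit_mul n), arrow_ident,
      Category.comp_id]
  | comul n =>
    rw [initial, initial, initial, Category.assoc, Category.assoc, ← arrow_comp, ← arrow_comp,
      arrow_eq (Eqv.unit_comul n), arrow_eq (Eqv.unit_nat (unit n))]
  | unit n => rfl
  | counit n =>
    rw [initial, Category.assoc, ← arrow_comp, arrow_eq (Eqv.unit_counit n), arrow_ident,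
      Category.comp_id]
  | symm n =>
    rw [initial, initial, Category.assoc, Category.assoc, Category.assoc, ← arrow_comp,
      arrow_eq (Eqv.unit_symm n), ← arrow_comp, ← arrow_comp, arrow_eq (Eqv.unit_nat (unit n))]

/-- The arrow `n → m` of `RB` in normal form that relates `i < n` to the `j < m` with `R i j`. -/
noncomputable def normal : (n m : ℕ) → (ℕ → ℕ → Prop) → (of n ⟶ of m)
  | 0, m, _ => initial m
  | n + 1, m, R => shift (normal n m fun i => R (i + 1)) ≫ absorb m (R 0)

theorem normal_arrow {n a b : ℕ} (R : ℕ → ℕ → Prop) (f : Term a b) :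
    normal n a R ≫ arrow f = normal n b fun i => f.translate.act (R i) := by
  induction n generalizing R with
  | zero => exact initial_arrow f
  | succ n ih =>
    rw [normal, normal, Category.assoc, absorb_arrow, ← Category.assoc, ← shift_comp, ih]

theorem normal_eq (n : ℕ) : normal n n (fun i j => j = i) = 𝟙 (of n) := by
  induction n with
  | zero => rfl
  | succ n ih =>
    have h₁ : normal n (n + 1) (fun i j => j = i + 1) = arrow (unit n) := by
      have h := normal_arrow (n := n) (fun i j => j = i) (unit n)
      rw [ih, Category.id_comp] at h
      refine Eq.trans ?_ h.symm
      congr 1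
      funext i j
      rcases j with _ | j <;> simp [act_unit_zero, act_unit_succ]
    have h₂ : absorb (n + 1) (fun j => j = 0) = extend True (arrow (counit n)) := by
      rw [absorb, ← absorb_false]
      simp
    rw [normal, h₁, h₂]
    exact monad.map_η_extend_ε (of n)

/-- Arrow terms of `RB` whose translations act in the same way are equal in `RB`. -/
theorem arrow_eq_of_act {n m : ℕ} {f g : Term n m} (h : f.translate.act = g.translate.act) :
    arrow f = arrow g := by
  rw [← Category.id_comp (arrow f), ← Category.id_comp (arrow g), ← normal_eq, normal_arrow,
    normal_arrow, h]

/-! ### Every relation comes from an arrow of `RB` -/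

/-- The arrow `absorb m S` of `RB`, as an arrow term and with its action. -/
theorem exists_absorb (m : ℕ) (S : ℕ → Prop) : ∃ f : Term (m + 1) m,
    ∀ T, ∀ j < m, f.translate.act T j ↔ (T 0 ∧ S j) ∨ T (j + 1) := by
  induction m generalizing S with
  | zero => exact ⟨counit 0, fun T j hj => absurd hj (Nat.not_lt_zero j)⟩
  | succ m ih =>
    obtain ⟨f, hf⟩ := ih fun j => S (j + 1)
    have h₀ : ∀ T, ∀ j < m + 1, (comp (map f) (symm m)).translate.act T j ↔
        (T 0 ∧ j ≠ 0 ∧ S j) ∨ T (j + 1) := by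
      intro T j hj
      rcases j with _ | j
      · simp [act_comp, act_map_zero, act_symm_zero]
      · rw [act_comp, act_map_succ, hf _ _ (by omega), act_symm_one, act_symm_add_two]
        simp
    by_cases h : S 0
    · refine ⟨comp (comp (map f) (symm m)) (comp (map (mul m)) (comul (m + 1))), ?_⟩
      intro T j hj
      rw [act_comp, h₀ _ _ hj, act_comp, act_map_zero, act_comul_zero, act_map_succ]
      rcases j with _ | j
      · simp [act_mul_zero, act_comul_succ, h]
      · simp [act_mul_succ, act_comul_succ]
    · refine ⟨comp (map f) (symm m), fun T j hj => ?_⟩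
      rw [h₀ _ _ hj]
      rcases j with _ | j <;> simp [h]

theorem exists_act_zero (m : ℕ) : ∃ f : Term 0 m, ∀ T, ∀ j < m, ¬ f.translate.act T j := by
  induction m with
  | zero => exact ⟨ident 0, fun T j hj => absurd hj (Nat.not_lt_zero j)⟩
  | succ m ih =>
    obtain ⟨f, hf⟩ := ih
    refine ⟨comp (unit m) f, fun T j hj => ?_⟩
    rw [act_comp]
    rcases j with _ | j
    · simp [act_unit_zero]
    · rw [act_unit_succ]
      exact hf T j (by omega)

theorem exists_act (n m : ℕ) (R : ℕ → ℕ → Prop) : ∃ f : Term n m,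
    ∀ T, ∀ j < m, f.translate.act T j ↔ ∃ i < n, T i ∧ R i j := by
  induction n generalizing R with
  | zero =>
    obtain ⟨f, hf⟩ := exists_act_zero m
    exact ⟨f, fun T j hj => by simp [hf T j hj]⟩
  | succ n ih =>
    obtain ⟨f, hf⟩ := ih fun i => R (i + 1)
    obtain ⟨g, hg⟩ := exists_absorb m (R 0)
    refine ⟨comp g (map f), fun T j hj => ?_⟩
    rw [act_comp, hg _ _ hj, act_map_zero, act_map_succ, hf _ _ hj]
    constructor
    · rintro (h | ⟨i, hi, h⟩)
      · exact ⟨0, by omega, h⟩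
      · exact ⟨i + 1, by omega, h⟩
    · rintro ⟨_ | i, hi, h⟩
      · exact Or.inl h
      · exact Or.inr ⟨i, by omega, h⟩

/-- Every arrow of `RB_I` is the translation of an arrow of `RB`. -/
theorem exists_translate {n m : ℕ} (g : RBI.Term n m) :
    ∃ f : Term n m, f.translate.act = g.act := by
  obtain ⟨f, hf⟩ := exists_act n m fun i => g.act fun k => k = i
  refine ⟨f, RBI.Term.act_eq_iff.2 ?_⟩
  ext ⟨i, j⟩
  rw [RBI.Term.mem_rel, RBI.Term.mem_rel, hf _ _ j.2]
  refine ⟨?_, fun h => ⟨i, i.2, rfl, h⟩⟩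
  rintro ⟨_, _, rfl, h⟩
  exact h

end RB

/-! ### The universal property of `RB` -/

namespace RB

open Term

section Lift

variable {A : Type u} [Category.{v} A] (B : RelBialgMonad A) (a : A)

/-- The object `Mⁿ a`. -/
def iterate : ℕ → A
  | 0 => a
  | n + 1 => B.obj (iterate n)

/-- The interpretation of the arrow terms of `RB` in a relational bialgebraic monad. -/
def interpret : {n m : ℕ} → Term n m → (iterate B a n ⟶ iterate B a m)
  | _, _, .ident _ => 𝟙 _
  | _, _, .comp g f => interpret f ≫ interpret g
  | _, _, .map f => B.map (interpret f)
  | _, _, .mul n => B.μ.app (iterate B a n)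
  | _, _, .comul n => B.δ.app (iterate B a n)
  | _, _, .unit n => B.η.app (iterate B a n)
  | _, _, .counit n => B.ε.app (iterate B a n)
  | _, _, .symm n => B.τ.app (iterate B a n)

theorem interpret_eq {n m : ℕ} {f g : Term n m} (h : Eqv f g) :
    interpret B a f = interpret B a g := by
  induction h with
  | refl f => rfl
  | symm _ ih => exact ih.symm
  | trans _ _ ih ih' => exact ih.trans ih'
  | comp_congr _ _ ih ih' => rw [interpret, interpret, ih, ih']
  | map_congr _ ih => rw [interpret, interpret, ih]
  | id_comp f => exact Category.id_comp _
  | comp_id f => exact Category.comp_id _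
  | assoc h g f => exact (Category.assoc _ _ _).symm
  | map_id n => exact B.map_id _
  | map_comp g f => exact B.map_comp _ _
  | mul_nat f => exact B.μ_nat _
  | comul_nat f => exact B.δ_nat _
  | unit_nat f => exact B.η_nat _
  | counit_nat f => exact B.ε_nat _
  | symm_nat f => exact B.τ_nat _
  | mul_assoc n => exact (B.assoc _).symm
  | unit_mul n => exact B.left_unit _
  | mul_unit n => exact B.right_unit _
  | comul_assoc n => exact (B.coassoc _).symm
  | counit_comul n => exact B.left_counit _
  | comul_counit n => exact B.right_counit _
  | symm_symm n => exact B.τ_τ _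
  | yang_baxter n =>
    exact (Category.assoc _ _ _).trans ((B.yang_baxter _).trans (Category.assoc _ _ _).symm)
  | mul_comm n => exact B.τ_mul _
  | comul_comm n => exact B.comul_τ _
  | mul_symm n => exact (B.mul_symm _).trans (Category.assoc _ _ _).symm
  | comul_symm n => exact (B.comul_symm _).trans (Category.assoc _ _ _).symm
  | unit_symm n => exact B.unit_symm _
  | counit_symm n => exact B.counit_symm _
  | unit_counit n => exact B.unit_counit _
  | mul_counit n => exact B.mul_counit _
  | unit_comul n => exact B.unit_comul _
  | mul_comul n =>
    exact (B.mul_comul _).trans <| Eq.symm <| (Category.assoc _ _ _).trans <|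
      (Category.assoc _ _ _).trans (Category.assoc _ _ _)
  | separable n => exact B.separable _

/-- The functor from `RB` that sends the generating object to `a`. -/
def lift : RB ⥤ A where
  obj X := iterate B a X.val
  map f := Quotient.lift (interpret B a) (fun _ _ h => interpret_eq B a h) f
  map_comp f g := Quotient.inductionOn₂ f g fun _ _ => rfl

theorem lift_isStrictHom : monad.IsStrictHom B (lift B a) where
  comm := Functor.hext (fun _ => rfl) fun X Y f => by
    obtain ⟨f, rfl⟩ := arrow_surjective f
    rfl
  map_mul _ := HEq.rfl
  map_comul _ := HEq.rfl
  map_unit _ := HEq.rfl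
  map_counit _ := HEq.rfl
  map_symm _ := HEq.rfl

variable {B a}

theorem obj_eq_iterate {F : RB ⥤ A} (h₀ : F.obj (of 0) = a) (hF : monad.IsStrictHom B F) (n : ℕ) :
    F.obj (of n) = iterate B a n := by
  induction n with
  | zero => exact h₀
  | succ n ih => exact (Functor.congr_obj hF.comm (of n)).trans (congrArg B.obj ih)

theorem map_heq_interpret {F : RB ⥤ A} (h₀ : F.obj (of 0) = a) (hF : monad.IsStrictHom B F)
    {n m : ℕ} (f : Term n m) : HEq (F.map (arrow f)) (interpret B a f) := by
  have hobj := obj_eq_iterate h₀ hF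
  have happ : ∀ (X Y : A), X = Y → ∀ {G : A ⥤ A} {H : A ⥤ A} (θ : G ⟶ H),
      HEq (θ.app X) (θ.app Y) := by
    rintro X _ rfl G H θ
    rfl
  induction f with
  | ident n =>
    rw [arrow_ident, F.map_id, interpret, hobj]
  | @comp a b c g f ihg ihf =>
    have h : ∀ (X Y Z X' Y' Z' : A) (f : X ⟶ Y) (g : Y ⟶ Z) (f' : X' ⟶ Y') (g' : Y' ⟶ Z'),
        X = X' → Y = Y' → Z = Z' → HEq f f' → HEq g g' → HEq (f ≫ g) (f' ≫ g') := by
      rintro X Y Z _ _ _ f g f' g' rfl rfl rfl ⟨⟩ ⟨⟩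
      rfl
    rw [arrow_comp, F.map_comp, interpret]
    exact h _ _ _ _ _ _ _ _ _ _ (hobj _) (hobj _) (hobj _) ihf ihg
  | @map b c f ih =>
    have h : ∀ (X Y X' Y' : A) (f : X ⟶ Y) (f' : X' ⟶ Y'), X = X' → Y = Y' → HEq f f' →
        HEq (B.map f) (B.map f') := by
      rintro X Y _ _ f f' rfl rfl ⟨⟩
      rfl
    exact (Functor.hcongr_hom hF.comm (arrow f)).trans
      (h _ _ _ _ _ _ (hobj _) (hobj _) ih)
  | mul n => exact (hF.map_mul (of n)).trans (happ _ _ (hobj n) B.μ)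
  | comul n => exact (hF.map_comul (of n)).trans (happ _ _ (hobj n) B.δ)
  | unit n => exact (hF.map_unit (of n)).trans (happ _ _ (hobj n) B.η)
  | counit n => exact (hF.map_counit (of n)).trans (happ _ _ (hobj n) B.ε)
  | symm n => exact (hF.map_symm (of n)).trans (happ _ _ (hobj n) B.τ)

theorem eq_lift {F : RB ⥤ A} (h₀ : F.obj (of 0) = a) (hF : monad.IsStrictHom B F) :
    F = lift B a :=
  Functor.hext (fun X => obj_eq_iterate h₀ hF X.val) fun X Y f => by
    obtain ⟨f, rfl⟩ := arrow_surjective f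
    exact map_heq_interpret h₀ hF f

end Lift

end RB

/-! ### The isomorphisms between `RB`, `RB_I` and `Rel` -/

/-- A functor that is bijective on objects and on arrows is an isomorphism of categories. -/
theorem isIso_toCatHom_of_bijective {C D : Type u} [Category.{v} C] [Category.{v} D] (F : C ⥤ D)
    (e : D → C) (he : ∀ X, e (F.obj X) = X) (he' : ∀ Y, F.obj (e Y) = Y)
    (hF : ∀ X Y, Function.Bijective fun f : X ⟶ Y => F.map f) : IsIso F.toCatHom := by
  have : F.Faithful := ⟨fun h => (hF _ _).1 h⟩
  have : F.Full := ⟨(hF _ _).2⟩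
  let G : D ⥤ C :=
    { obj := e
      map := fun {Y Z} g => F.preimage (eqToHom (he' Y) ≫ g ≫ eqToHom (he' Z).symm)
      map_id := fun Y => F.map_injective (by simp)
      map_comp := fun f g => F.map_injective (by simp) }
  have h : F ⋙ G = 𝟭 C := CategoryTheory.Functor.ext he fun X Y f => F.map_injective (by simp [G, eqToHom_map])
  have h' : G ⋙ F = 𝟭 D := CategoryTheory.Functor.ext he' fun X Y f => by simp [G]
  exact ⟨G.toCatHom, Cat.Hom.ext h, Cat.Hom.ext h'⟩

/-- The functor from `RB` to `RB_I` that is given by the translation of arrow terms. -/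
def RB.toRBI : RB ⥤ RBI where
  obj X := ⟨X.val⟩
  map f := Quotient.lift (fun f => RBI.arrow (Term.translate f))
    (fun _ _ h => RBI.arrow_eq_of_act (RB.Eqv.act_eq h)) f
  map_comp f g := Quotient.inductionOn₂ f g fun _ _ => rfl

theorem RB.toRBI_bijective (X Y : RB) :
    Function.Bijective fun f : X ⟶ Y => toRBI.map f := by
  constructor
  · intro f g h
    obtain ⟨f, rfl⟩ := arrow_surjective f
    obtain ⟨g, rfl⟩ := arrow_surjective g
    exact arrow_eq_of_act (RBI.arrow_eq_iff_act.1 h)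
  · intro g
    obtain ⟨g, rfl⟩ := RBI.arrow_surjective g
    obtain ⟨f, hf⟩ := exists_translate g
    exact ⟨arrow f, RBI.arrow_eq_of_act hf⟩

/-- The functor from `RB_I` to `Rel` that sends an arrow term to its relation. -/
def RBI.toRel : RBI ⥤ RelOrd where
  obj X := ⟨X.val⟩
  map f := Quotient.lift (fun f => Term.rel f)
    (fun _ _ h => Term.act_eq_iff.1 (RBI.Eqv.act_eq h)) f
  map_id X := by
    change (Term.ident X.val).rel = SetRel.id
    ext ⟨i, j⟩
    exact Fin.ext_iff.symm
  map_comp f g := Quotient.inductionOn₂ f g fun _ _ => rfl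

theorem RBI.exists_rel_eq {n m : ℕ} (R : SetRel (Fin n) (Fin m)) :
    ∃ g : Term n m, g.rel = R := by
  obtain ⟨f, hf⟩ := RB.exists_act n m fun i j => ∃ hi hj, (⟨i, hi⟩, ⟨j, hj⟩) ∈ R
  refine ⟨f.translate, ?_⟩
  ext ⟨i, j⟩
  rw [Term.mem_rel, hf _ _ j.2]
  constructor
  · rintro ⟨_, _, rfl, _, _, h⟩
    exact h
  · exact fun h => ⟨i, i.2, rfl, i.2, j.2, h⟩

theorem RBI.toRel_bijective (X Y : RBI) :
    Function.Bijective fun f : X ⟶ Y => toRel.map f := by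
  constructor
  · intro f g h
    obtain ⟨f, rfl⟩ := arrow_surjective f
    obtain ⟨g, rfl⟩ := arrow_surjective g
    exact arrow_eq_iff_rel.2 h
  · intro R
    obtain ⟨g, hg⟩ := exists_rel_eq R
    exact ⟨arrow g, hg⟩


instance RB.isIso_toRBI : IsIso toRBI.toCatHom :=
  isIso_toCatHom_of_bijective _ (fun Y => ⟨Y.val⟩) (fun _ => rfl) (fun _ => rfl) toRBI_bijective

instance RBI.isIso_toRel : IsIso toRel.toCatHom :=
  isIso_toCatHom_of_bijective _ (fun Y => ⟨Y.val⟩) (fun _ => rfl) (fun _ => rfl) toRel_bijective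

/-! ### The strict biproduct of `RB_I` -/

namespace RBI

open Term

theorem arrow_heq {a b a' b' : ℕ} {f : Term a b} {g : Term a' b'} (ha : a = a') (hb : b = b')
    (h : act f = act g) : HEq (arrow f) (arrow g) := by
  subst ha hb
  exact heq_of_eq (arrow_eq_of_act h)

theorem inl_plus {n m k l : ℕ} (f : of n ⟶ of m) (g : of k ⟶ of l) :
    arrow (inl n k) ≫ plus f g = f ≫ arrow (inl m l) := by
  rw [inl_eq_pair, inl_eq_pair, pair_plus, comp_pair, Category.id_comp, Category.comp_id, zero_comp,
    comp_zero]

theorem inr_plus {n m k l : ℕ} (f : of n ⟶ of m) (g : of k ⟶ of l) :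
    arrow (inr n k) ≫ plus f g = g ≫ arrow (inr m l) := by
  rw [inr_eq_pair, inr_eq_pair, pair_plus, comp_pair, Category.id_comp, Category.comp_id, zero_comp,
    comp_zero]

theorem inl_nabla (n : ℕ) : arrow (inl n n) ≫ arrow (nabla n) = 𝟙 (of n) :=
  arrow_eq (Eqv.nabla_bang_one n)

theorem inr_nabla (n : ℕ) : arrow (inr n n) ≫ arrow (nabla n) = 𝟙 (of n) :=
  arrow_eq (Eqv.nabla_bang_two n)

theorem isZero_zero : IsZero (of 0) where
  unique_to X := ⟨⟨⟨arrow (bang X.val)⟩, fun _ => from_zero_eq _ _⟩⟩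
  unique_from X := ⟨⟨⟨arrow (cobang X.val)⟩, fun _ => to_zero_eq _ _⟩⟩

theorem isStrictBiproduct : IsStrictBiproduct (of 0) sumObj
    (fun a b => arrow (inl a.val b.val)) (fun a b => arrow (inr a.val b.val))
    (fun a b => arrow (fst a.val b.val)) (fun a b => arrow (snd a.val b.val)) sumMap where
  isZero := isZero_zero
  coproduct a b := by
    refine ⟨BinaryCofan.isColimitMk
      (fun s => plus s.inl s.inr ≫ arrow (nabla s.pt.val)) (fun s => ?_) (fun s => ?_)
      (fun s m h₁ h₂ => ?_)⟩
    · exact (Category.assoc _ _ _).symm.trans <| (congrArg (· ≫ _) (inl_plus _ _)).trans <|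
        (Category.assoc _ _ _).trans <| (congrArg (s.inl ≫ ·) (inl_nabla _)).trans
          (Category.comp_id _)
    · exact (Category.assoc _ _ _).symm.trans <| (congrArg (· ≫ _) (inr_plus _ _)).trans <|
        (Category.assoc _ _ _).trans <| (congrArg (s.inr ≫ ·) (inr_nabla _)).trans
          (Category.comp_id _)
    · exact (eq_copair m).trans
        (congrArg₂ (fun x y => plus x y ≫ arrow (nabla s.pt.val)) h₁ h₂)
  product a b := by
    refine ⟨BinaryFan.isLimitMk (fun s => pair s.fst s.snd)
      (fun s => pair_fst _ _) (fun s => pair_snd _ _) (fun s m h₁ h₂ => ?_)⟩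
    exact (eq_pair m).trans (congrArg₂ pair h₁ h₂)
  inl_fst a b := by rw [inl_eq_pair]; exact pair_fst _ _
  inr_snd a b := by rw [inr_eq_pair]; exact pair_snd _ _
  inl_snd a b := by
    rw [inl_eq_pair]
    exact (pair_snd _ _).trans <| congrArg₂ (· ≫ ·)
      (to_zero_eq (arrow (cobang a.val)) (isZero_zero.from_ a))
      (from_zero_eq (arrow (bang b.val)) (isZero_zero.to_ b))
  inr_fst a b := by
    rw [inr_eq_pair]
    exact (pair_fst _ _).trans <| congrArg₂ (· ≫ ·)
      (to_zero_eq (arrow (cobang b.val)) (isZero_zero.from_ b))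
      (from_zero_eq (arrow (bang a.val)) (isZero_zero.to_ a))
  inl_sum f g := inl_plus f g
  inr_sum f g := inr_plus f g
  sum_fst f g := plus_fst f g
  sum_snd f g := plus_snd f g
  add_assoc a b c := congrArg of (Nat.add_assoc a.val b.val c.val)
  add_zero a := rfl
  zero_add a := congrArg of (Nat.zero_add a.val)
  inl_assoc a b c := by
    refine arrow_heq (f := comp (inl (a.val + b.val) c.val) (inl a.val b.val))
      (g := inl a.val (b.val + c.val)) rfl (Nat.add_assoc _ _ _) ?_
    funext S j
    simp only [act, inl]
    split_ifs <;> first | omega | rfl | (congr 1; omega)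
  mid_assoc a b c := by
    refine arrow_heq (f := comp (inl (a.val + b.val) c.val) (inr a.val b.val))
      (g := comp (inr a.val (b.val + c.val)) (inl b.val c.val)) rfl (Nat.add_assoc _ _ _) ?_
    funext S j
    simp only [act, inl, inr]
    split_ifs <;> first | omega | rfl | (congr 1; omega)
  inr_assoc a b c := by
    refine arrow_heq (f := inr (a.val + b.val) c.val)
      (g := comp (inr a.val (b.val + c.val)) (inr b.val c.val)) rfl (Nat.add_assoc _ _ _) ?_
    funext S j
    simp only [act, inr]
    split_ifs <;> first | omega | rfl | (congr 1; omega)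
  fst_assoc a b c := by
    refine arrow_heq (f := comp (fst a.val b.val) (fst (a.val + b.val) c.val))
      (g := fst a.val (b.val + c.val)) (Nat.add_assoc _ _ _) rfl ?_
    funext S j
    simp only [act, fst]
    split_ifs <;> first | omega | rfl | (congr 1; omega)
  fst_snd_assoc a b c := by
    refine arrow_heq (f := comp (snd a.val b.val) (fst (a.val + b.val) c.val))
      (g := comp (fst b.val c.val) (snd a.val (b.val + c.val))) (Nat.add_assoc _ _ _) rfl ?_
    funext S j
    simp only [act, fst, snd]
    split_ifs <;> first | omega | rfl | (congr 1; omega)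
  snd_assoc a b c := by
    refine arrow_heq (f := snd (a.val + b.val) c.val)
      (g := comp (snd b.val c.val) (snd a.val (b.val + c.val))) (Nat.add_assoc _ _ _) rfl ?_
    funext S j
    simp only [act, snd]
    split_ifs <;> first | omega | rfl | (congr 1; omega)
  inl_zero a := by
    refine arrow_heq (f := inl a.val 0) (g := ident a.val) rfl rfl ?_
    funext S j
    simp only [act, inl, ident]
    split_ifs <;> first | omega | rfl
  inr_zero a := by
    refine arrow_heq (f := inr 0 a.val) (g := ident a.val) rfl (Nat.zero_add _) ?_
    funext S j
    simp only [act, inr, ident]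
    split_ifs <;> first | omega | rfl
  fst_zero a := by
    refine arrow_heq (f := fst a.val 0) (g := ident a.val) rfl rfl ?_
    funext S j
    simp only [act, fst, ident]
    split_ifs <;> first | omega | rfl
  snd_zero a := by
    refine arrow_heq (f := snd 0 a.val) (g := ident a.val) (Nat.zero_add _) rfl ?_
    funext S j
    simp only [act, snd, ident]
    split_ifs <;> first | omega | rfl

/-! ### The iota normal form -/

namespace Term

theorem act_zero {n m j : ℕ} (S : ℕ → Prop) (hj : j < m) : ¬ act (zero n m) S j := by
  simp [zero, act_comp, act_bang, hj]

theorem act_iota {n m : ℕ} (p : Fin n × Fin m) (S : ℕ → Prop) {j : ℕ} (hj : j < m) :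
    act (iota p) S j ↔ S p.1 ∧ j = p.2 := by
  have h₁ := p.1.2
  have h₂ := p.2.2
  rw [iota, act_add, act_add]
  split_ifs with h h'
  · simpa [h'.ne] using act_zero S h'
  · have e : j = p.2 := by omega
    simp [act_ident, e]
  · have e : j ≠ p.2 := by omega
    simpa [e] using act_zero _ (by omega)

theorem act_union {n m : ℕ} (f g : Term n m) (S : ℕ → Prop) {j : ℕ} (hj : j < m) :
    act (union f g) S j ↔ act f S j ∨ act g S j := by
  have hf := act_congr f (S := act (delta n) S) (T := S) (fun i hi => by simp [act_delta, hi]) hj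
  have hg : (fun i => act (delta n) S (i + n)) = S := by
    funext i
    simp [act_delta]
  rw [union, act_comp, act_nabla, if_pos hj, act_comp, act_add, act_add, if_pos hj,
    if_neg (by omega), Nat.add_sub_cancel, hf, hg]

theorem act_iotaUnion {n m : ℕ} (L : List (Fin n × Fin m)) (S : ℕ → Prop) {j : ℕ} (hj : j < m) :
    act (iotaUnion L) S j ↔ ∃ p ∈ L, S p.1 ∧ j = p.2 := by
  match L with
  | [] => simpa [iotaUnion] using act_zero S hj
  | [p] => simp [iotaUnion, act_iota p S hj]
  | p :: q :: L =>
    rw [iotaUnion, act_union _ _ _ hj, act_iota p S hj, act_iotaUnion (q :: L) S hj]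
    simp

theorem rel_iotaUnion {n m : ℕ} (L : List (Fin n × Fin m)) (p : Fin n × Fin m) :
    p ∈ (iotaUnion L).rel ↔ p ∈ L := by
  obtain ⟨i, j⟩ := p
  rw [mem_rel, act_iotaUnion L _ j.2]
  constructor
  · rintro ⟨⟨i', j'⟩, h, hi, hj⟩
    rwa [Fin.ext hj, ← Fin.ext hi]
  · exact fun h => ⟨_, h, rfl, rfl⟩

end Term

theorem arrow_eq_iotaUnion_iff {n m : ℕ} (f : Term n m) (L : List (Fin n × Fin m)) :
    arrow f = arrow (iotaUnion L) ↔ ∀ p, p ∈ L ↔ p ∈ f.rel := by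
  rw [arrow_eq_iff_rel, Set.ext_iff]
  simp only [rel_iotaUnion]
  exact forall_congr' fun _ => Iff.comm

open Classical in
theorem exists_iotaUnion {n m : ℕ} (f : Term n m) : ∃ L : List (Fin n × Fin m), L.Nodup ∧
    arrow f = arrow (iotaUnion L) := by
  refine ⟨(Finset.univ.filter (· ∈ f.rel)).toList, Finset.nodup_toList _, ?_⟩
  rw [arrow_eq_iotaUnion_iff]
  simp

end RBI

theorem mainTheorem3 :
    -- `RB` is the relational bialgebraic monad freely generated by the single object `0`
    (∀ (A : Type u) [Category.{v} A] (B : RelBialgMonad A) (a : A),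
      ∃! F : RB ⥤ A, F.obj (RB.of 0) = a ∧ RB.monad.IsStrictHom B F) ∧
    -- `RB_I` has strictified finite biproducts, with `∇` and `Δ` as codiagonal and diagonal, and
    -- satisfies generalized bialgebraic separability
    IsStrictBiproduct (RBI.of 0) RBI.sumObj
      (fun a b => RBI.arrow (.inl a.val b.val)) (fun a b => RBI.arrow (.inr a.val b.val))
      (fun a b => RBI.arrow (.fst a.val b.val)) (fun a b => RBI.arrow (.snd a.val b.val))
      RBI.sumMap ∧
    (∀ n : ℕ,
      RBI.arrow (.inl n n) ≫ RBI.arrow (.nabla n) = 𝟙 (RBI.of n) ∧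
      RBI.arrow (.inr n n) ≫ RBI.arrow (.nabla n) = 𝟙 (RBI.of n) ∧
      RBI.arrow (.delta n) ≫ RBI.arrow (.fst n n) = 𝟙 (RBI.of n) ∧
      RBI.arrow (.delta n) ≫ RBI.arrow (.snd n n) = 𝟙 (RBI.of n) ∧
      RBI.arrow (.delta n) ≫ RBI.arrow (.nabla n) = 𝟙 (RBI.of n)) ∧
    -- the categories `RB`, `RB_I` and `Rel` are isomorphic
    (∃ (K : RB ⥤ RBI) (G : RBI ⥤ RelOrd),
      IsIso K.toCatHom ∧ IsIso G.toCatHom ∧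
      (∀ n : ℕ, K.obj (RB.of n) = RBI.of n) ∧
      (∀ (n m : ℕ) (f : RB.Term n m), HEq (K.map (RB.arrow f)) (RBI.arrow f.translate)) ∧
      (∀ n : ℕ, G.obj (RBI.of n) = RelOrd.of n) ∧
      (∀ (n m : ℕ) (f : RBI.Term n m), HEq (G.map (RBI.arrow f)) f.rel)) ∧
    -- iota normal form: every arrow term of `RB_I` is equal in `RB_I` to a union of iota terms, and
    -- the iota terms in such a union correspond to the pairs of the relation of the arrow term
    (∀ (n m : ℕ) (f : RBI.Term n m),
      (∃ L : List (Fin n × Fin m), L.Nodup ∧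
        RBI.arrow f = RBI.arrow (RBI.Term.iotaUnion L)) ∧
      ∀ L : List (Fin n × Fin m), RBI.arrow f = RBI.arrow (RBI.Term.iotaUnion L) ↔
        ∀ p, p ∈ L ↔ p ∈ f.rel) := by
  refine ⟨fun A _ B a => ?_, RBI.isStrictBiproduct, fun n => ?_, ?_, fun n m f => ?_⟩
  · exact ⟨RB.lift B a, ⟨rfl, RB.lift_isStrictHom B a⟩, fun F hF => RB.eq_lift hF.1 hF.2⟩
  · exact ⟨RBI.inl_nabla n, RBI.inr_nabla n, RBI.arrow_eq (.delta_cobang_one n),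
      RBI.arrow_eq (.delta_cobang_two n), RBI.arrow_eq (.nabla_delta n)⟩
  · exact ⟨RB.toRBI, RBI.toRel, inferInstance, inferInstance, fun _ => rfl, fun _ _ _ => HEq.rfl,
      fun _ => rfl, fun _ _ _ => HEq.rfl⟩
  · exact ⟨RBI.exists_iotaUnion f, RBI.arrow_eq_iotaUnion_iff f⟩
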